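/- **Setting.** Let $E$ be a finite set of $m$ resources and let $\mathcal P_i\subseteq 2^E$ be a non-empty set of strategies of agent $i$. Let $E_i=\bigcup_{p\in\mathcal P_i}p$ be the set of active resources and $m_i=|E_i|$. Let $\mathcal X_i\subseteq[0,1]^E$ be the convex hull of the indicator vectors of the strategies in $\mathcal P_i$, and for $\mu\ge 0$ let $\mathcal X_i^{\mu}=\{x\in\mathcal X_i: x_e\ge\mu \text{ for all } e\in E_i\}$. A Carathéodory decomposition of $x\in\mathcal X_i$ is a probability distribution $\pi$ on $\mathcal P_i$ with support of size at most $m+1$ such that $x_e=\Pr_{p\sim\pi}[e\in p]$ for all $e\in E$. Put $\gamma_t=t^{-3/5}$ and $\mu_t=\min(1/m_i,\,t^{-1/5})$. **Algorithm (SBGD-CE).** The agent starts at an arbitrary $x^1\in\mathcal X_i^{\mu_1}$. In each round $t=1,\dots,T$ she chooses a Carathéodory decomposition $\pi^t$ of $x^t$; an adversary, who may know everything that has happened so far but not the coming sample, chooses costs $c^t:E\to\mathbb R_{\ge0}$; the agent samples $p^t\sim\pi^t$ and pays $\sum_{e\in p^t}c^t_e$. She sets $\hat c^t_e=c^t_e\,\mathbf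 1[e\in p^t]/x^t_e$ (with $0/0=0$) and $x^{t+1}=\Pi_{\mathcal X_i^{\mu_{t+1}}}\bigl[x^t-\gamma_t\hat c^t\bigr]$, where $\Pi$ is the Euclidean projection. **Theorem 3.6.** There is an absolute constant $C>0$ such that for all $E$, $\mathcal P_i$, all $T$, all $c_{\max}\ge1$ and every adaptive adversary with $\|c^t\|_\infty\le c_{\max}$ for all $t$, the following hold. 1. For every $\delta\in(0,1/2]$, with probability at least $1-\delta$, $$\sum_{t=1}^T\sum_{e\in p^t}c^t_e-\min_{p^\star\in\mathcal P_i}\sum_{t=1}^T\sum_{e\in p^\star}c^t_e\;\le\; C\,\bigl(m\,c_{\max}^2+m^2c_{\max}\bigr)\,T^{4/5}\log(1/\delta).$$ 2. The regret is integrable and satisfies $$\mathbb E\Bigl[\sum_{t=1}^T\mathbb E_{p\sim\pi^t}\Bigl[\sum_{e\in p}c^t_e\Bigr]-\min_{p^\star\in\mathcal P_i}\sum_{t=1}^T\sum_{e\in p^\star}c^t_e\Bigr]\;\le\; C\,m^2c_{\max}^2\,T^{4/5}.$$ -/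

import Mathlib

open MeasureTheory

/-- The `0/1` indicator vector of a strategy (a set of resources). -/
noncomputable def stratVec {E : Type*} [Fintype E] [DecidableEq E] (q : Finset E) :
    EuclideanSpace ℝ E :=
  WithLp.toLp 2 (fun e => if e ∈ q then (1 : ℝ) else 0)

/-- The description polytope of the strategy space `P`: the convex hull of the indicator vectors
of the strategies. -/
def descPolytope {E : Type*} [Fintype E] [DecidableEq E] (P : Finset (Finset E)) :
    Set (EuclideanSpace ℝ E) :=
  convexHull ℝ (stratVec '' (P : Set (Finset E)))

/-- The active resources: those that belong to at least one strategy. -/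
def activeRes {E : Type*} [Fintype E] [DecidableEq E] (P : Finset (Finset E)) : Finset E :=
  Finset.univ.filter (fun e => ∃ q ∈ P, e ∈ q)

/-- The `μ`-bounded-away description polytope. -/
def boundedAway {E : Type*} [Fintype E] [DecidableEq E] (P : Finset (Finset E)) (μ : ℝ) :
    Set (EuclideanSpace ℝ E) :=
  {x | x ∈ descPolytope P ∧ ∀ e ∈ activeRes P, μ ≤ x e}

/-- `w` is a Carathéodory decomposition of `x`: a probability distribution on the strategies in
`P`, supported on at most `m + 1` of them, in which every resource `e` is selected with
probability `x e`. -/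
structure IsCaratheodory {E : Type*} [Fintype E] [DecidableEq E] (P : Finset (Finset E))
    (x : EuclideanSpace ℝ E) (w : Finset E → ℝ) : Prop where
  nonneg : ∀ q, 0 ≤ w q
  eq_zero : ∀ q, q ∉ P → w q = 0
  sum_eq_one : ∑ q ∈ P, w q = 1
  support_card : (P.filter (fun q => w q ≠ 0)).card ≤ Fintype.card E + 1
  marginal : ∀ e, x e = ∑ q ∈ P.filter (fun q => e ∈ q), w q

/-- `z` is a Euclidean projection of `y` onto the set `K`. -/
def IsEuclideanProj {E : Type*} [Fintype E] (K : Set (EuclideanSpace ℝ E))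
    (y z : EuclideanSpace ℝ E) : Prop :=
  z ∈ K ∧ ∀ w ∈ K, ‖y - z‖ ≤ ‖y - w‖

/-- The step size `γ_t = t ^ (-3/5)`. -/
noncomputable def stepSize (t : ℕ) : ℝ := (t : ℝ) ^ (-(3 / 5) : ℝ)

/-- The exploration parameter `μ_t = min (1 / m_i) (t ^ (-1/5))`, where `m_i` is the number of
active resources (so that `μ_1 = 1 / m_i`). -/
noncomputable def explParam {E : Type*} [Fintype E] [DecidableEq E] (P : Finset (Finset E))
    (t : ℕ) : ℝ :=
  min (1 / ((activeRes P).card : ℝ)) ((t : ℝ) ^ (-(1 / 5) : ℝ))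

/-- The importance-weighted estimate `ĉ e = c e * 1[e ∈ q] / x e` of the cost vector `c`, when the
strategy `q` was sampled from the fractional point `x`. -/
noncomputable def costEstimate {E : Type*} [Fintype E] [DecidableEq E]
    (x : EuclideanSpace ℝ E) (q : Finset E) (c : E → ℝ) : EuclideanSpace ℝ E :=
  WithLp.toLp 2 (fun e => c e * (if e ∈ q then (1 : ℝ) else 0) / x e)

/-- The cost of the strategy `q` under the resource costs `c`. -/
def stratCost {E : Type*} (c : E → ℝ) (q : Finset E) : ℝ := ∑ e ∈ q, c e

/-- A run, for `T` rounds `t = 1, …, T`, of semi-bandit gradient descent with Carathéodory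
exploration on the strategy space `P` against an adaptive adversary.

`x t` is the fractional point, `w t` the mixed strategy, `c t` the cost vector of the adversary and
`p t` the sampled strategy of round `t`. The σ-algebra `ℱ t` is the information present in
round `t` just before `p t` is sampled: it may contain anything that happened in the earlier
rounds, private randomness of the adversary, and the choices of `x t`, `w t` and `c t`. -/
structure IsSBGDCERun {E : Type*} [Fintype E] [DecidableEq E] (P : Finset (Finset E)) (T : ℕ)
    {Ω : Type*} {mΩ : MeasurableSpace Ω} (Pr : Measure Ω) (ℱ : Filtration ℕ mΩ)
    (x : ℕ → Ω → EuclideanSpace ℝ E) (w : ℕ → Ω → Finset E → ℝ)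
    (p : ℕ → Ω → Finset E) (c : ℕ → Ω → E → ℝ) : Prop where
  /-- All choices made before the sampling step are determined by `ℱ t`. -/
  meas_x : ∀ t, 1 ≤ t → t ≤ T → ∀ e, Measurable[ℱ t] (fun ω => x t ω e)
  meas_w : ∀ t, 1 ≤ t → t ≤ T → ∀ q, Measurable[ℱ t] (fun ω => w t ω q)
  meas_c : ∀ t, 1 ≤ t → t ≤ T → ∀ e, Measurable[ℱ t] (fun ω => c t ω e)
  /-- The sampled strategy is known once the round is over. -/
  meas_p : ∀ t, 1 ≤ t → t ≤ T → ∀ q, MeasurableSet[ℱ (t + 1)] {ω | p t ω = q}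
  p_mem : ∀ t, 1 ≤ t → t ≤ T → ∀ ω, p t ω ∈ P
  /-- The starting point is an arbitrary point of the first bounded-away polytope. -/
  init : 1 ≤ T → ∀ ω, x 1 ω ∈ boundedAway P (explParam P 1)
  /-- `w t` is a Carathéodory decomposition of `x t`. -/
  decomp : ∀ t, 1 ≤ t → t ≤ T → ∀ ω, IsCaratheodory P (x t ω) (w t ω)
  /-- Given the information in `ℱ t`, the strategy `p t` is sampled from `w t`. -/
  sample : ∀ t, 1 ≤ t → t ≤ T → ∀ q,
    Pr[Set.indicator {ω | p t ω = q} (fun _ => (1 : ℝ)) | ℱ t] =ᵐ[Pr] fun ω => w t ω q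
  /-- The projected gradient step onto the next bounded-away polytope. -/
  update : ∀ t, 1 ≤ t → t < T → ∀ ω,
    IsEuclideanProj (boundedAway P (explParam P (t + 1)))
      (x t ω - stepSize t • costEstimate (x t ω) (p t ω) (c t ω)) (x (t + 1) ω)

/-- The total cost over `T` rounds of the best fixed strategy in hindsight. -/
noncomputable def bestFixedCost {E : Type*} (P : Finset (Finset E)) (hP : P.Nonempty) (T : ℕ)
    (c : ℕ → E → ℝ) : ℝ :=
  P.inf' hP (fun q => ∑ t ∈ Finset.Icc 1 T, stratCost (c t) q)

/-- The realized regret of the strategies `p 1, …, p T` under the costs `c 1, …, c T`. -/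
noncomputable def realizedRegret {E : Type*} (P : Finset (Finset E)) (hP : P.Nonempty) (T : ℕ)
    (p : ℕ → Finset E) (c : ℕ → E → ℝ) : ℝ :=
  ∑ t ∈ Finset.Icc 1 T, stratCost (c t) (p t) - bestFixedCost P hP T c

/-- The regret of the mixed strategies `w 1, …, w T` under the costs `c 1, …, c T`: in each
round the expected cost of a strategy drawn from `w t` is charged. -/
noncomputable def mixedRegret {E : Type*} (P : Finset (Finset E)) (hP : P.Nonempty) (T : ℕ)
    (w : ℕ → Finset E → ℝ) (c : ℕ → E → ℝ) : ℝ :=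
  ∑ t ∈ Finset.Icc 1 T, ∑ q ∈ P, w t q * stratCost (c t) q - bestFixedCost P hP T c

/-! ### Geometry of the strategy polytope and the comparators -/

section Polytope

variable {E : Type*} [Fintype E] [DecidableEq E] {P : Finset (Finset E)}

/-! Fix a strategy `q` and write m = |E|, K for the cost bound, r = T^(1/5). Online gradient descent
is compared not with the vertex of `q`, which may lie outside the bounded-away polytope, but with
moving comparators z_t, obtained by shifting that vertex towards an interior point `a` with weight
λ_t = m_i μ_t. Since the sampled cost equals ⟨ĉ, x⟩ exactly, the regret against `q` splits into
three sums: ⟨ĉ, x - z_t⟩, ⟨ĉ - c, z_t⟩ and ⟨c, z_t - 1_q⟩.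

The first is bounded by a potential argument (`gradient_descent_regret`) and costs about m r³ plus
the sum of γ_t ‖ĉ‖², which is O(m K² r⁴) because ĉ ≤ K r. The third is at most the sum of m² K
t^(-1/5), that is O(m² K r⁴). Both bounds are pathwise (`regret_against_le`).

The second is a martingale with increments at most m K r. An Azuma-Hoeffding bound on its
exponential moment (`integral_exp_sampled_sum_le`) and a union over at most 2^m strategies give O(m²
K r⁴ log(1/δ)). The union is needed because an adaptive adversary makes the best strategy random.
For the expectation, the same moments bound the mean of the maximum over `q`, and mixed and realized
costs have equal means.

The bound ĉ ≤ K r needs m ≤ r. If r ≤ m, the trivial regret bound T m K is already small enough. -/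

theorem stratVec_apply (q : Finset E) (e : E) :
    stratVec q e = if e ∈ q then (1 : ℝ) else 0 := rfl

theorem costEstimate_apply (x : EuclideanSpace ℝ E) (q : Finset E) (c : E → ℝ) (e : E) :
    costEstimate x q c e = c e * (if e ∈ q then (1 : ℝ) else 0) / x e := rfl

theorem mem_activeRes {e : E} : e ∈ activeRes P ↔ ∃ q ∈ P, e ∈ q := by
  simp [activeRes]

theorem stratVec_mem_descPolytope {q : Finset E} (hq : q ∈ P) : stratVec q ∈ descPolytope P :=
  subset_convexHull ℝ _ ⟨q, hq, rfl⟩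

theorem convex_descPolytope : Convex ℝ (descPolytope P) := convex_convexHull ℝ _

theorem convex_boundedAway (μ : ℝ) : Convex ℝ (boundedAway P μ) := by
  rintro x ⟨hx, hx'⟩ y ⟨hy, hy'⟩ a b ha hb hab
  refine ⟨convex_descPolytope hx hy ha hb hab, fun e he => ?_⟩
  have h1 := mul_le_mul_of_nonneg_left (hx' e he) ha
  have h2 := mul_le_mul_of_nonneg_left (hy' e he) hb
  have : μ = a * μ + b * μ := by rw [← add_mul, hab, one_mul]
  simp only [PiLp.add_apply, PiLp.smul_apply, smul_eq_mul]
  linarith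

theorem boundedAway_antitone {μ ν : ℝ} (h : μ ≤ ν) : boundedAway P ν ⊆ boundedAway P μ :=
  fun _ hx => ⟨hx.1, fun e he => h.trans (hx.2 e he)⟩

theorem descPolytope_coord {x : EuclideanSpace ℝ E} (hx : x ∈ descPolytope P) (e : E) :
    0 ≤ x e ∧ x e ≤ 1 ∧ (e ∉ activeRes P → x e = 0) := by
  have hconv : Convex ℝ {y : EuclideanSpace ℝ E | 0 ≤ y e ∧ y e ≤ 1 ∧
      (e ∉ activeRes P → y e = 0)} := by
    rintro y ⟨hy0, hy1, hy⟩ z ⟨hz0, hz1, hz⟩ a b ha hb hab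
    simp only [Set.mem_ofPred_eq, PiLp.add_apply, PiLp.smul_apply, smul_eq_mul]
    refine ⟨by positivity, ?_, fun he => by rw [hy he, hz he]; simp⟩
    nlinarith
  refine convexHull_min ?_ hconv hx
  rintro _ ⟨q, hq, rfl⟩
  simp only [Set.mem_ofPred_eq, stratVec_apply]
  refine ⟨by split_ifs <;> norm_num, by split_ifs <;> norm_num, fun he => if_neg fun h => ?_⟩
  exact he (mem_activeRes.2 ⟨q, hq, h⟩)

/-- For each active resource pick a strategy containing it; the uniform average of these picks
works. With no active resource any strategy serves. -/
theorem exists_interior_point (hP : P.Nonempty) :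
    ∃ a ∈ descPolytope P, ∀ e ∈ activeRes P, 1 / ((activeRes P).card : ℝ) ≤ a e := by
  rcases (activeRes P).eq_empty_or_nonempty with h | h
  · obtain ⟨q, hq⟩ := hP
    exact ⟨stratVec q, stratVec_mem_descPolytope hq, by simp [h]⟩
  · have hsel : ∀ e : E, ∃ q ∈ P, e ∈ activeRes P → e ∈ q := by
      intro e
      by_cases he : e ∈ activeRes P
      · obtain ⟨q, hq, heq⟩ := mem_activeRes.1 he
        exact ⟨q, hq, fun _ => heq⟩
      · obtain ⟨q, hq⟩ := hP
        exact ⟨q, hq, fun h => absurd h he⟩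
    choose f hf hf' using hsel
    have hc : (0 : ℝ) < (activeRes P).card := by exact_mod_cast h.card_pos
    refine ⟨∑ e ∈ activeRes P, (1 / ((activeRes P).card : ℝ)) • stratVec (f e),
      convex_descPolytope.sum_mem (fun _ _ => by positivity) ?_
        fun e _ => stratVec_mem_descPolytope (hf e), fun e he => ?_⟩
    · rw [Finset.sum_const, nsmul_eq_mul]
      field_simp
    · have : (∑ i ∈ activeRes P, (1 / ((activeRes P).card : ℝ)) • stratVec (f i)) e =
          ∑ i ∈ activeRes P, (1 / ((activeRes P).card : ℝ)) * stratVec (f i) e := by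
        simp
      rw [this]
      refine le_trans ?_ (Finset.single_le_sum (fun i _ => mul_nonneg (by positivity)
        (descPolytope_coord (stratVec_mem_descPolytope (hf i)) e).1) he)
      rw [stratVec_apply, if_pos (hf' e he), mul_one]

/-- The weight of the interior point in the comparator of round `t`. -/
noncomputable def mixWeight (P : Finset (Finset E)) (t : ℕ) : ℝ :=
  (activeRes P).card * explParam P t

theorem explParam_nonneg (t : ℕ) : 0 ≤ explParam P t :=
  le_min (by positivity) (by positivity)

theorem explParam_antitone {s t : ℕ} (hs : 1 ≤ s) (hst : s ≤ t) :
    explParam P t ≤ explParam P s :=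
  min_le_min le_rfl (Real.rpow_le_rpow_of_nonpos (by exact_mod_cast hs)
    (by exact_mod_cast hst) (by norm_num))

theorem mixWeight_nonneg (t : ℕ) : 0 ≤ mixWeight P t :=
  mul_nonneg (by positivity) (explParam_nonneg t)

theorem mixWeight_le_one (t : ℕ) : mixWeight P t ≤ 1 := by
  refine (mul_le_mul_of_nonneg_left (min_le_left _ _) (by positivity)).trans ?_
  rw [mul_one_div]
  exact div_self_le_one _

theorem mixWeight_antitone {s t : ℕ} (hs : 1 ≤ s) (hst : s ≤ t) :
    mixWeight P t ≤ mixWeight P s :=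
  mul_le_mul_of_nonneg_left (explParam_antitone hs hst) (by positivity)

theorem mixWeight_le (t : ℕ) :
    mixWeight P t ≤ (Fintype.card E : ℝ) * (t : ℝ) ^ (-(1 / 5) : ℝ) :=
  mul_le_mul (by exact_mod_cast Finset.card_le_univ _) (min_le_right _ _)
    (explParam_nonneg t) (by positivity)

/-- The comparator of round `t`: the strategy `q`, moved towards the interior point `a`. -/
noncomputable def comparator (P : Finset (Finset E)) (a : EuclideanSpace ℝ E) (q : Finset E)
    (t : ℕ) : EuclideanSpace ℝ E :=
  (1 - mixWeight P t) • stratVec q + mixWeight P t • a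

theorem comparator_apply (a : EuclideanSpace ℝ E) (q : Finset E) (t : ℕ) (e : E) :
    comparator P a q t e = (1 - mixWeight P t) * stratVec q e + mixWeight P t * a e := by
  simp [comparator]

theorem comparator_mem {a : EuclideanSpace ℝ E} (ha : a ∈ descPolytope P)
    (ha' : ∀ e ∈ activeRes P, 1 / ((activeRes P).card : ℝ) ≤ a e) {q : Finset E} (hq : q ∈ P)
    (t : ℕ) : comparator P a q t ∈ boundedAway P (explParam P t) := by
  have h1 := mixWeight_le_one (P := P) t
  have h0 := mixWeight_nonneg (P := P) t
  refine ⟨convex_descPolytope (stratVec_mem_descPolytope hq) ha (by linarith) h0 (by ring),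
    fun e he => ?_⟩
  rw [comparator_apply]
  have hs := (descPolytope_coord (stratVec_mem_descPolytope hq) e).1
  have hc : (0 : ℝ) < (activeRes P).card := by exact_mod_cast Finset.card_pos.2 ⟨e, he⟩
  -- The weight is m_i μ_t precisely so that the share of `a`, at least 1/m_i in each active
  -- coordinate, contributes μ_t.
  have h2 : explParam P t = mixWeight P t * (1 / ((activeRes P).card : ℝ)) := by
    unfold mixWeight; field_simp
  have h3 := mul_le_mul_of_nonneg_left (ha' e he) h0
  have h4 := mul_nonneg (sub_nonneg.2 h1) hs
  linarith

end Polytope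

/-! ### Euclidean projection and one gradient step -/

section Projection

variable {E : Type*} [Fintype E]

/-- The variational inequality makes the angle at the projection obtuse, so expanding the square
around `z` drops only nonnegative terms. -/
theorem IsEuclideanProj.norm_sub_sq_le {K : Set (EuclideanSpace ℝ E)} (hK : Convex ℝ K)
    {y z w : EuclideanSpace ℝ E} (h : IsEuclideanProj K y z) (hw : w ∈ K) :
    ‖z - w‖ ^ 2 ≤ ‖y - w‖ ^ 2 := by
  have hinf : ‖y - z‖ = ⨅ v : K, ‖y - v‖ := by
    have : Nonempty K := ⟨⟨z, h.1⟩⟩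
    refine le_antisymm (le_ciInf fun v => h.2 v v.2) ?_
    exact ciInf_le ⟨0, by rintro _ ⟨v, rfl⟩; exact norm_nonneg _⟩ (⟨z, h.1⟩ : K)
  have hvar := (norm_eq_iInf_iff_real_inner_le_zero hK h.1).1 hinf w hw
  have hid : ‖y - w‖ ^ 2 = ‖y - z‖ ^ 2 + 2 * inner ℝ (y - z) (z - w) + ‖z - w‖ ^ 2 := by
    rw [← norm_add_sq_real, sub_add_sub_cancel]
  have hneg : inner ℝ (y - z) (z - w) = - inner ℝ (y - z) (w - z) := by
    rw [← inner_neg_right, neg_sub]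
  nlinarith [sq_nonneg ‖y - z‖]

theorem norm_sq_step (x z g : EuclideanSpace ℝ E) (γ : ℝ) :
    ‖x - γ • g - z‖ ^ 2 = ‖x - z‖ ^ 2 - 2 * γ * ∑ e, g e * (x e - z e) + γ ^ 2 * ∑ e, g e ^ 2 := by
  simp only [EuclideanSpace.real_norm_sq_eq, PiLp.sub_apply, PiLp.smul_apply, smul_eq_mul,
    Finset.mul_sum, ← Finset.sum_sub_distrib, ← Finset.sum_add_distrib]
  exact Finset.sum_congr rfl fun e _ => by ring

end Projection

/-! ### Sums of negative powers -/

section PowerSums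

theorem sum_rpow_neg_le {s : ℝ} (h0 : 0 < s) (h1 : s < 1) (n : ℕ) :
    ∑ t ∈ Finset.Icc 1 n, (t : ℝ) ^ (-s) ≤ (n : ℝ) ^ (1 - s) / (1 - s) := by
  have hs : 0 < 1 - s := by linarith
  induction n with
  | zero => simp [Real.zero_rpow hs.ne']
  | succ n ih =>
    rw [Finset.sum_Icc_succ_top (by omega)]
    refine (add_le_add_left ih _).trans ?_
    set N : ℝ := ((n + 1 : ℕ) : ℝ) with hN
    have hNpos : 0 < N := by rw [hN]; positivity
    have hn : (n : ℝ) = N * (1 + -(1 / N)) := by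
      rw [hN]; push_cast; field_simp; ring
    have hN1 : 1 / N ≤ 1 := by
      rw [div_le_one hNpos, hN]; push_cast; linarith [(Nat.cast_nonneg n : (0 : ℝ) ≤ n)]
    -- Bernoulli for an exponent in (0, 1): it bounds the new term by an increment of N^(1-s)/(1-s),
    -- and the sum telescopes.
    have hb : (1 + -(1 / N)) ^ (1 - s) ≤ 1 + (1 - s) * -(1 / N) :=
      rpow_one_add_le_one_add_mul_self (by linarith) hs.le (by linarith)
    have hle : (n : ℝ) ^ (1 - s) ≤ N ^ (1 - s) - (1 - s) * N ^ (-s) := by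
      rw [hn, Real.mul_rpow hNpos.le (by linarith)]
      refine (mul_le_mul_of_nonneg_left hb (by positivity)).trans (le_of_eq ?_)
      have : N ^ (1 - s) = N * N ^ (-s) := by
        rw [sub_eq_add_neg, Real.rpow_add hNpos, Real.rpow_one]
      rw [this]
      field_simp
      ring
    rw [← le_sub_iff_add_le, div_le_iff₀ hs, sub_mul, div_mul_cancel₀ _ hs.ne']
    linarith

end PowerSums

/-! ### Gradient descent against a moving comparator -/

section GradientDescent

variable {E : Type*} [Fintype E] [DecidableEq E] {P : Finset (Finset E)}

theorem norm_sub_sq_le_card {u v : EuclideanSpace ℝ E} (hu : u ∈ descPolytope P)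
    (hv : v ∈ descPolytope P) : ‖u - v‖ ^ 2 ≤ Fintype.card E := by
  rw [EuclideanSpace.real_norm_sq_eq]
  calc ∑ e, (u - v) e ^ 2 ≤ ∑ _e : E, (1 : ℝ) := Finset.sum_le_sum fun e _ => by
        obtain ⟨h1, h2, -⟩ := descPolytope_coord hu e
        obtain ⟨h3, h4, -⟩ := descPolytope_coord hv e
        rw [PiLp.sub_apply, sq_le_one_iff_abs_le_one, abs_le]
        constructor <;> linarith
    _ = Fintype.card E := by simp

/-- Moving the comparator raises the squared distance by at most 2m(λ_t - λ_{t+1}), since in each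
coordinate the difference of squares is (λ_t - λ_{t+1}) times factors of size at most 1 and 2.
Adding 2mλ_t to the potential absorbs this drift. -/
theorem norm_sub_comparator_succ {a y : EuclideanSpace ℝ E} {q : Finset E}
    (ha : a ∈ descPolytope P) (hq : q ∈ P) (hy : y ∈ descPolytope P) {t : ℕ} (ht : 1 ≤ t) :
    ‖y - comparator P a q (t + 1)‖ ^ 2 + 2 * Fintype.card E * mixWeight P (t + 1) ≤
      ‖y - comparator P a q t‖ ^ 2 + 2 * Fintype.card E * mixWeight P t := by
  have hcard : (Fintype.card E : ℝ) = ∑ _e : E, (1 : ℝ) := by simp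
  rw [EuclideanSpace.real_norm_sq_eq, EuclideanSpace.real_norm_sq_eq, hcard, Finset.mul_sum,
    Finset.sum_mul, Finset.sum_mul, ← Finset.sum_add_distrib, ← Finset.sum_add_distrib]
  refine Finset.sum_le_sum fun e _ => ?_
  simp only [PiLp.sub_apply, comparator_apply]
  obtain ⟨y0, y1, -⟩ := descPolytope_coord hy e
  obtain ⟨a0, a1, -⟩ := descPolytope_coord ha e
  obtain ⟨q0, q1, -⟩ := descPolytope_coord (stratVec_mem_descPolytope hq) e
  have hl := mixWeight_antitone (P := P) ht (Nat.le_succ t)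
  have l0 := mixWeight_nonneg (P := P) (t + 1)
  have l1 := mixWeight_le_one (P := P) t
  simp only [Nat.succ_eq_add_one] at hl
  generalize mixWeight P (t + 1) = l' at *
  generalize mixWeight P t = l at *
  generalize y e = y at *
  generalize a e = a at *
  generalize stratVec q e = s at *
  have hz : ∀ k : ℝ, 0 ≤ k → k ≤ 1 → 0 ≤ (1 - k) * s + k * a ∧ (1 - k) * s + k * a ≤ 1 := by
    intro k hk0 hk1
    constructor <;> nlinarith
  obtain ⟨u0, u1⟩ := hz l' l0 (hl.trans l1)
  obtain ⟨v0, v1⟩ := hz l (l0.trans hl) l1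
  have hid : (y - ((1 - l') * s + l' * a)) ^ 2 - (y - ((1 - l) * s + l * a)) ^ 2 =
      (l - l') * ((a - s) * (2 * y - ((1 - l) * s + l * a) - ((1 - l') * s + l' * a))) := by ring
  have hab : (a - s) * (2 * y - ((1 - l) * s + l * a) - ((1 - l') * s + l' * a)) ≤ 2 := by
    generalize (1 - l) * s + l * a = v at *
    generalize (1 - l') * s + l' * a = u at *
    refine (le_abs_self _).trans ?_
    rw [abs_mul]
    have h1 : |a - s| ≤ 1 := abs_le.2 ⟨by linarith, by linarith⟩
    have h2 : |2 * y - v - u| ≤ 2 := abs_le.2 ⟨by linarith, by linarith⟩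
    nlinarith [abs_nonneg (a - s), abs_nonneg (2 * y - v - u)]
  nlinarith [mul_le_mul_of_nonneg_left hab (sub_nonneg.2 hl)]

theorem stepSize_pos {t : ℕ} (ht : 1 ≤ t) : 0 < stepSize t :=
  Real.rpow_pos_of_pos (by exact_mod_cast ht) _

theorem inv_stepSize (t : ℕ) : (stepSize t)⁻¹ = (t : ℝ) ^ (3 / 5 : ℝ) := by
  rw [stepSize, Real.rpow_neg (Nat.cast_nonneg t), inv_inv]

variable {T : ℕ} {x g : ℕ → EuclideanSpace ℝ E} {a : EuclideanSpace ℝ E} {q : Finset E}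

/-- The potential b_t, squared distance plus 2mλ_t, stays below 3m. Dividing each step inequality by
γ_t and summing by parts leaves 3m times the last inverse step size. -/
theorem gradient_descent_potential
    (hx : ∀ t, 1 ≤ t → t ≤ T → x t ∈ boundedAway P (explParam P t))
    (hup : ∀ t, 1 ≤ t → t < T →
      IsEuclideanProj (boundedAway P (explParam P (t + 1))) (x t - stepSize t • g t) (x (t + 1)))
    (ha : a ∈ descPolytope P)
    (ha' : ∀ e ∈ activeRes P, 1 / ((activeRes P).card : ℝ) ≤ a e) (hq : q ∈ P)
    {n : ℕ} (hn : n < T) :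
    ∑ t ∈ Finset.Icc 1 n, 2 * ∑ e, g t e * (x t e - comparator P a q t e) +
      (‖x (n + 1) - comparator P a q (n + 1)‖ ^ 2 +
        2 * Fintype.card E * mixWeight P (n + 1)) * ((n + 1 : ℕ) : ℝ) ^ (3 / 5 : ℝ) ≤
      3 * Fintype.card E * ((n + 1 : ℕ) : ℝ) ^ (3 / 5 : ℝ) +
        ∑ t ∈ Finset.Icc 1 n, stepSize t * ∑ e, g t e ^ 2 := by
  have hb : ∀ t, 1 ≤ t → t ≤ T → ‖x t - comparator P a q t‖ ^ 2 +
      2 * Fintype.card E * mixWeight P t ≤ 3 * Fintype.card E := by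
    intro t h1 h2
    have := norm_sub_sq_le_card (hx t h1 h2).1 (comparator_mem ha ha' hq t).1
    have := mul_le_mul_of_nonneg_left (mixWeight_le_one (P := P) t)
      (by positivity : (0 : ℝ) ≤ 2 * Fintype.card E)
    linarith
  induction n with
  | zero => simpa using hb 1 le_rfl hn
  | succ n ih =>
    rw [Finset.sum_Icc_succ_top (by omega), Finset.sum_Icc_succ_top (by omega)]
    have ih' := ih (by omega)
    -- The polytopes grow as μ_t decreases, so the current comparator is feasible for the next
    -- projection.
    have hstep := (hup (n + 1) (by omega) hn).norm_sub_sq_le (convex_boundedAway _)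
      (boundedAway_antitone (explParam_antitone (by omega) (Nat.le_succ _))
        (comparator_mem ha ha' hq (n + 1)))
    rw [norm_sq_step] at hstep
    have hmove := norm_sub_comparator_succ ha hq (hx (n + 1 + 1) (by omega) (by omega)).1
      (t := n + 1) (by omega)
    have hbn := hb (n + 1 + 1) (by omega) (by omega)
    have hγ := stepSize_pos (t := n + 1) (by omega)
    have hmono : ((n + 1 : ℕ) : ℝ) ^ (3 / 5 : ℝ) ≤ ((n + 1 + 1 : ℕ) : ℝ) ^ (3 / 5 : ℝ) :=
      Real.rpow_le_rpow (by positivity) (by push_cast; linarith) (by norm_num)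
    rw [← inv_stepSize] at ih' hmono
    generalize ((n + 1 + 1 : ℕ) : ℝ) ^ (3 / 5 : ℝ) = G at *
    generalize ‖x (n + 1 + 1) - comparator P a q (n + 1 + 1)‖ ^ 2 +
        2 * (Fintype.card E : ℝ) * mixWeight P (n + 1 + 1) = b' at *
    generalize stepSize (n + 1) = γ at *
    generalize ∑ e, g (n + 1) e * (x (n + 1) e - comparator P a q (n + 1) e) = r at *
    generalize ∑ e, g (n + 1) e ^ 2 = s at *
    have h1 : 2 * γ * r ≤ (‖x (n + 1) - comparator P a q (n + 1)‖ ^ 2 +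
        2 * Fintype.card E * mixWeight P (n + 1)) - b' + γ ^ 2 * s := by linarith
    generalize ‖x (n + 1) - comparator P a q (n + 1)‖ ^ 2 +
        2 * (Fintype.card E : ℝ) * mixWeight P (n + 1) = b at *
    have h2 : 2 * r ≤ (b - b') * γ⁻¹ + γ * s := by
      have := mul_le_mul_of_nonneg_right h1 (inv_pos.2 hγ).le
      field_simp at this ⊢
      linarith
    -- Summation by parts: raising the coefficient of b' from 1/γ to `G` costs at most 3m(G - 1/γ).
    have h3 := mul_nonneg (sub_nonneg.2 hbn) (sub_nonneg.2 hmono)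
    linarith

theorem gradient_descent_regret (hT : 1 ≤ T)
    (hx : ∀ t, 1 ≤ t → t ≤ T → x t ∈ boundedAway P (explParam P t))
    (hup : ∀ t, 1 ≤ t → t < T →
      IsEuclideanProj (boundedAway P (explParam P (t + 1))) (x t - stepSize t • g t) (x (t + 1)))
    (ha : a ∈ descPolytope P)
    (ha' : ∀ e ∈ activeRes P, 1 / ((activeRes P).card : ℝ) ≤ a e) (hq : q ∈ P) :
    ∑ t ∈ Finset.Icc 1 T, 2 * ∑ e, g t e * (x t e - comparator P a q t e) ≤
      3 * Fintype.card E * (T : ℝ) ^ (3 / 5 : ℝ) +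
        ∑ t ∈ Finset.Icc 1 T, stepSize t * ∑ e, g t e ^ 2 := by
  obtain ⟨n, rfl⟩ : ∃ n, T = n + 1 := ⟨T - 1, by omega⟩
  have h := gradient_descent_potential hx hup ha ha' hq (Nat.lt_succ_self n)
  rw [Finset.sum_Icc_succ_top (by omega), Finset.sum_Icc_succ_top (by omega)]
  have hγ := stepSize_pos (t := n + 1) (by omega)
  have hl := mixWeight_nonneg (P := P) (n + 1)
  have hid := norm_sq_step (x (n + 1)) (comparator P a q (n + 1)) (g (n + 1)) (stepSize (n + 1))
  -- Round T has no projection after it; nonnegativity of the unprojected squared distance replaces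
  -- it.
  have hpos := sq_nonneg ‖x (n + 1) - stepSize (n + 1) • g (n + 1) - comparator P a q (n + 1)‖
  rw [hid] at hpos
  rw [← inv_stepSize] at h ⊢
  have h2 : 2 * ∑ e, g (n + 1) e * (x (n + 1) e - comparator P a q (n + 1) e) ≤
      ‖x (n + 1) - comparator P a q (n + 1)‖ ^ 2 * (stepSize (n + 1))⁻¹ +
        stepSize (n + 1) * ∑ e, g (n + 1) e ^ 2 := by
    have := mul_nonneg hpos (inv_pos.2 hγ).le
    field_simp at this ⊢
    linarith
  have h3 : 0 ≤ 2 * (Fintype.card E : ℝ) * mixWeight P (n + 1) * (stepSize (n + 1))⁻¹ := by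
    positivity
  linarith

end GradientDescent

/-! ### Exponential moments of adaptively sampled sums -/

section Sampling

variable {Ω α : Type*} {m mΩ : MeasurableSpace Ω} {μ : Measure Ω} [IsProbabilityMeasure μ]

/-- As the sample takes finitely many values, h(p) is the sum of h_q 1[p = q]. Each h_q is known
before sampling, so it pulls out of the conditional expectation, which turns the indicator into w_q.
-/
theorem integral_sampled {P : Finset α} {p : Ω → α} {w : Ω → α → ℝ} {h : α → Ω → ℝ} {K : ℝ}
    (hm : m ≤ mΩ) (hp : ∀ ω, p ω ∈ P) (hpm : ∀ q, MeasurableSet {ω | p ω = q})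
    (hw : ∀ q, μ[Set.indicator {ω | p ω = q} (fun _ => (1 : ℝ)) | m] =ᵐ[μ] fun ω => w ω q)
    (hh : ∀ q ∈ P, Measurable[m] (h q)) (hK : ∀ q ∈ P, ∀ ω, |h q ω| ≤ K) :
    Integrable (fun ω => h (p ω) ω) μ ∧ Integrable (fun ω => ∑ q ∈ P, w ω q * h q ω) μ ∧
      ∫ ω, h (p ω) ω ∂μ = ∫ ω, ∑ q ∈ P, w ω q * h q ω ∂μ := by
  classical
  set ind : α → Ω → ℝ := fun q => Set.indicator {ω | p ω = q} (fun _ => (1 : ℝ)) with hind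
  have hindi : ∀ q, Integrable (ind q) μ := fun q =>
    (integrable_const (1 : ℝ)).indicator (hpm q)
  have hsplit : (fun ω => h (p ω) ω) = fun ω => ∑ q ∈ P, (h q * ind q) ω := by
    funext ω
    rw [Finset.sum_eq_single_of_mem (p ω) (hp ω)]
    · simp [hind]
    · intro q _ hq
      simp [hind, Ne.symm hq]
  have hprod : ∀ q ∈ P, Integrable (h q * ind q) μ := fun q hq =>
    (hindi q).bdd_mul ((hh q hq).mono hm le_rfl).aestronglyMeasurable
      (Filter.Eventually.of_forall (hK q hq))
  have hpull : ∀ q ∈ P, μ[h q * ind q | m] =ᵐ[μ] fun ω => w ω q * h q ω := by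
    intro q hq
    have h1 := condExp_mul_of_stronglyMeasurable_left (hh q hq).stronglyMeasurable
      (hprod q hq) (hindi q)
    filter_upwards [h1, hw q] with ω h1 h2
    rw [h1, Pi.mul_apply, h2, mul_comm]
  have hwi : ∀ q ∈ P, Integrable (fun ω => w ω q * h q ω) μ := fun q hq =>
    integrable_condExp.congr (hpull q hq)
  refine ⟨?_, integrable_finsetSum _ hwi, ?_⟩
  · rw [hsplit]
    exact integrable_finsetSum _ hprod
  · rw [hsplit, integral_finsetSum _ hprod, integral_finsetSum _ hwi]
    refine Finset.sum_congr rfl fun q hq => ?_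
    rw [← integral_congr_ae (hpull q hq), integral_condExp hm]

/-- Hoeffding's lemma: exp lies below its chord over [-θB, θB]; the zero mean removes the sinh part,
and cosh u ≤ exp(u²/2). -/
theorem sum_mul_exp_le {P : Finset α} {w y : α → ℝ} {B θ : ℝ} (hB : 0 < B)
    (hw : ∀ q, 0 ≤ w q) (hw1 : ∑ q ∈ P, w q = 1) (hy : ∀ q ∈ P, |y q| ≤ B)
    (hmean : ∑ q ∈ P, w q * y q = 0) :
    ∑ q ∈ P, w q * Real.exp (θ * y q) ≤ Real.exp ((θ * B) ^ 2 / 2) := by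
  have hpt : ∀ q ∈ P, w q * Real.exp (θ * y q) ≤
      w q * Real.cosh (θ * B) + w q * y q * (Real.sinh (θ * B) / B) := by
    intro q hq
    obtain ⟨h1, h2⟩ := abs_le.1 (hy q hq)
    have hl : -1 ≤ y q / B := by rw [le_div_iff₀ hB]; linarith
    have hu : y q / B ≤ 1 := by rw [div_le_iff₀ hB]; linarith
    have hconv : Real.exp ((1 + y q / B) / 2 * (θ * B) + (1 - y q / B) / 2 * -(θ * B)) ≤
        (1 + y q / B) / 2 * Real.exp (θ * B) + (1 - y q / B) / 2 * Real.exp (-(θ * B)) := by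
      have hc := convexOn_exp.2
      exact hc (Set.mem_univ _) (Set.mem_univ _) (by linarith) (by linarith) (by ring)
    have harg : (1 + y q / B) / 2 * (θ * B) + (1 - y q / B) / 2 * -(θ * B) = θ * y q := by
      field_simp; ring
    rw [harg] at hconv
    refine (mul_le_mul_of_nonneg_left hconv (hw q)).trans (le_of_eq ?_)
    rw [Real.cosh_eq, Real.sinh_eq]
    ring
  calc _ ≤ ∑ q ∈ P, (w q * Real.cosh (θ * B) + w q * y q * (Real.sinh (θ * B) / B)) :=
        Finset.sum_le_sum hpt
    _ = Real.cosh (θ * B) := by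
        rw [Finset.sum_add_distrib, ← Finset.sum_mul, ← Finset.sum_mul, hw1, hmean]; simp
    _ ≤ _ := Real.cosh_le_exp_half_sq _

/-- Azuma-Hoeffding, with `y t s` the increment of round t if `s` were drawn. Measurability of the
partial sum is carried through the induction so that the past factors out of the next conditional
expectation. -/
theorem integral_exp_sampled_sum_le {P : Finset α} {T : ℕ} {ℱ : Filtration ℕ mΩ}
    {p : ℕ → Ω → α} {w : ℕ → Ω → α → ℝ} {y : ℕ → α → Ω → ℝ} {B : ℝ} (θ : ℝ) (hB : 0 < B)
    (hp : ∀ t, 1 ≤ t → t ≤ T → ∀ ω, p t ω ∈ P)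
    (hpm : ∀ t, 1 ≤ t → t ≤ T → ∀ q, MeasurableSet[ℱ (t + 1)] {ω | p t ω = q})
    (hs : ∀ t, 1 ≤ t → t ≤ T → ∀ q,
      μ[Set.indicator {ω | p t ω = q} (fun _ => (1 : ℝ)) | ℱ t] =ᵐ[μ] fun ω => w t ω q)
    (hw : ∀ t, 1 ≤ t → t ≤ T → ∀ ω q, 0 ≤ w t ω q)
    (hw1 : ∀ t, 1 ≤ t → t ≤ T → ∀ ω, ∑ q ∈ P, w t ω q = 1)
    (hym : ∀ t, 1 ≤ t → t ≤ T → ∀ q, Measurable[ℱ t] (y t q))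
    (hy : ∀ t, 1 ≤ t → t ≤ T → ∀ q ∈ P, ∀ ω, |y t q ω| ≤ B)
    (hmean : ∀ t, 1 ≤ t → t ≤ T → ∀ ω, ∑ q ∈ P, w t ω q * y t q ω = 0) {n : ℕ} (hn : n ≤ T) :
    Measurable[ℱ (n + 1)] (fun ω => ∑ t ∈ Finset.Icc 1 n, y t (p t ω) ω) ∧
      Integrable (fun ω => Real.exp (θ * ∑ t ∈ Finset.Icc 1 n, y t (p t ω) ω)) μ ∧
      ∫ ω, Real.exp (θ * ∑ t ∈ Finset.Icc 1 n, y t (p t ω) ω) ∂μ ≤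
        Real.exp (n * ((θ * B) ^ 2 / 2)) := by
  classical
  have hbd : ∀ k, k ≤ T → ∀ ω, |∑ t ∈ Finset.Icc 1 k, y t (p t ω) ω| ≤ k * B := by
    intro k hk ω
    refine (Finset.abs_sum_le_sum_abs _ _).trans ?_
    calc _ ≤ ∑ t ∈ Finset.Icc 1 k, B := Finset.sum_le_sum fun t ht => by
          obtain ⟨h1, h2⟩ := Finset.mem_Icc.1 ht
          exact hy t h1 (h2.trans hk) _ (hp t h1 (h2.trans hk) ω) ω
      _ = k * B := by simp
  induction n with
  | zero => simp
  | succ n ih =>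
    obtain ⟨ihm, -, ih⟩ := ih (by omega)
    have h1n : 1 ≤ n + 1 := by omega
    set h : α → Ω → ℝ := fun q ω => Real.exp (θ * ∑ t ∈ Finset.Icc 1 n, y t (p t ω) ω) *
      Real.exp (θ * y (n + 1) q ω) with hh
    have hsum : ∀ ω, ∑ t ∈ Finset.Icc 1 (n + 1), y t (p t ω) ω =
        ∑ t ∈ Finset.Icc 1 n, y t (p t ω) ω + y (n + 1) (p (n + 1) ω) ω := fun ω =>
      Finset.sum_Icc_succ_top (by omega) _
    have hexp : (fun ω => Real.exp (θ * ∑ t ∈ Finset.Icc 1 (n + 1), y t (p t ω) ω)) =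
        fun ω => h (p (n + 1) ω) ω := by
      funext ω
      rw [hh, hsum, mul_add, Real.exp_add]
    have hhm : ∀ q, Measurable[ℱ (n + 1)] (h q) := fun q =>
      (Real.measurable_exp.comp (ihm.const_mul θ)).mul
        (Real.measurable_exp.comp ((hym (n + 1) h1n hn q).const_mul θ))
    have hhK : ∀ q ∈ P, ∀ ω, |h q ω| ≤ Real.exp (|θ| * (n * B)) * Real.exp (|θ| * B) := by
      intro q hq ω
      rw [abs_of_nonneg (by positivity)]
      refine mul_le_mul (Real.exp_le_exp.2 ?_) (Real.exp_le_exp.2 ?_) (by positivity)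
        (by positivity)
      · refine (le_abs_self _).trans ?_
        rw [abs_mul]
        exact mul_le_mul_of_nonneg_left (hbd n (by omega) ω) (abs_nonneg _)
      · refine (le_abs_self _).trans ?_
        rw [abs_mul]
        exact mul_le_mul_of_nonneg_left (hy _ h1n hn q hq ω) (abs_nonneg _)
    obtain ⟨hi1, hi2, hint⟩ := integral_sampled (ℱ.le (n + 1)) (hp _ h1n hn)
      (fun q => ℱ.le _ _ (hpm _ h1n hn q)) (hs _ h1n hn) (fun q _ => hhm q) hhK
    have hexpi : Integrable (fun ω => Real.exp (θ * ∑ t ∈ Finset.Icc 1 n, y t (p t ω) ω)) μ := by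
      refine Integrable.of_bound
        ((Real.measurable_exp.comp (ihm.const_mul θ)).mono (ℱ.le _) le_rfl).aestronglyMeasurable
        (Real.exp (|θ| * (n * B))) (Filter.Eventually.of_forall fun ω => ?_)
      rw [Real.norm_eq_abs, abs_of_nonneg (by positivity)]
      refine Real.exp_le_exp.2 ((le_abs_self _).trans ?_)
      rw [abs_mul]
      exact mul_le_mul_of_nonneg_left (hbd n (by omega) ω) (abs_nonneg _)
    refine ⟨?_, by rw [hexp]; exact hi1, ?_⟩
    · have hlast : (fun ω => y (n + 1) (p (n + 1) ω) ω) = fun ω =>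
          ∑ q ∈ P, Set.indicator {ω | p (n + 1) ω = q} (y (n + 1) q) ω := by
        funext ω
        rw [Finset.sum_eq_single_of_mem _ (hp _ h1n hn ω)]
        · simp
        · intro q _ hq
          simp [Ne.symm hq]
      simp only [hsum]
      refine (ihm.mono (ℱ.mono (Nat.le_succ _)) le_rfl).add ?_
      rw [hlast]
      exact Finset.measurable_fun_sum _ fun q _ =>
        ((hym _ h1n hn q).mono (ℱ.mono (Nat.le_succ _)) le_rfl).indicator (hpm _ h1n hn q)
    · rw [hexp, hint]
      have hpt : ∀ ω, ∑ q ∈ P, w (n + 1) ω q * h q ω ≤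
          Real.exp (θ * ∑ t ∈ Finset.Icc 1 n, y t (p t ω) ω) * Real.exp ((θ * B) ^ 2 / 2) := by
        intro ω
        have := sum_mul_exp_le (θ := θ) hB (hw _ h1n hn ω) (hw1 _ h1n hn ω)
          (fun q hq => hy _ h1n hn q hq ω) (hmean _ h1n hn ω)
        refine le_trans (le_of_eq ?_) (mul_le_mul_of_nonneg_left this (Real.exp_pos _).le)
        rw [Finset.mul_sum]
        exact Finset.sum_congr rfl fun q _ => by rw [hh]; ring
      refine (integral_mono hi2 (hexpi.mul_const _) hpt).trans ?_
      rw [integral_mul_const]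
      refine (mul_le_mul_of_nonneg_right ih (Real.exp_pos _).le).trans (le_of_eq ?_)
      rw [← Real.exp_add]
      push_cast
      ring_nf

end Sampling

/-! ### Cost estimates and the pathwise regret bound -/

section Run

variable {E : Type*} [Fintype E] [DecidableEq E] {P : Finset (Finset E)}

theorem explParam_pos {e : E} (he : e ∈ activeRes P) {t : ℕ} (ht : 1 ≤ t) :
    0 < explParam P t := by
  have hc : (0 : ℝ) < (activeRes P).card := by exact_mod_cast Finset.card_pos.2 ⟨e, he⟩
  exact lt_min (by positivity) (Real.rpow_pos_of_pos (by exact_mod_cast ht) _)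

/-- The assumption m ≤ T^(1/5) ensures that the cap 1/m_i in μ_t does not fall below T^(-1/5). -/
theorem inv_le_explParam {e : E} (he : e ∈ activeRes P) {t T : ℕ} (ht : 1 ≤ t) (htT : t ≤ T)
    (hm : (Fintype.card E : ℝ) ≤ (T : ℝ) ^ (1 / 5 : ℝ)) :
    ((T : ℝ) ^ (1 / 5 : ℝ))⁻¹ ≤ explParam P t := by
  have hc : (0 : ℝ) < (activeRes P).card := by exact_mod_cast Finset.card_pos.2 ⟨e, he⟩
  have hcm : ((activeRes P).card : ℝ) ≤ Fintype.card E := by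
    exact_mod_cast Finset.card_le_univ _
  refine le_min ?_ ?_
  · rw [one_div ((activeRes P).card : ℝ)]
    exact inv_anti₀ hc (hcm.trans hm)
  · rw [← Real.rpow_neg (Nat.cast_nonneg T)]
    exact Real.rpow_le_rpow_of_nonpos (by exact_mod_cast ht) (by exact_mod_cast htT) (by norm_num)

theorem costEstimate_bounds {e : E} {t T : ℕ} (ht : 1 ≤ t) (htT : t ≤ T)
    (hm : (Fintype.card E : ℝ) ≤ (T : ℝ) ^ (1 / 5 : ℝ)) {x : EuclideanSpace ℝ E}
    (hx : x ∈ boundedAway P (explParam P t)) {q : Finset E} (hq : q ∈ P) {c : E → ℝ} {K : ℝ}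
    (hc0 : 0 ≤ c e) (hcK : c e ≤ K) :
    0 ≤ costEstimate x q c e ∧ costEstimate x q c e ≤ K * (T : ℝ) ^ (1 / 5 : ℝ) := by
  have hT : (0 : ℝ) < T := by exact_mod_cast (ht.trans htT)
  have hr : 0 < (T : ℝ) ^ (1 / 5 : ℝ) := Real.rpow_pos_of_pos hT _
  rw [costEstimate_apply]
  split_ifs with h
  · have he : e ∈ activeRes P := mem_activeRes.2 ⟨q, hq, h⟩
    have hxe : ((T : ℝ) ^ (1 / 5 : ℝ))⁻¹ ≤ x e := (inv_le_explParam he ht htT hm).trans (hx.2 e he)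
    have hxpos : 0 < x e := (inv_pos.2 hr).trans_le hxe
    rw [mul_one]
    refine ⟨by positivity, ?_⟩
    rw [div_eq_mul_inv]
    exact mul_le_mul hcK (inv_le_of_inv_le₀ hr hxe) (by positivity) (hc0.trans hcK)
  · simp only [mul_zero, zero_div, le_refl, true_and]
    exact mul_nonneg (hc0.trans hcK) hr.le

theorem stratCost_eq_sum (c : E → ℝ) (q : Finset E) :
    stratCost c q = ∑ e, c e * stratVec q e := by
  simp [stratCost, stratVec_apply]

theorem stratCost_eq_sum_costEstimate {x : EuclideanSpace ℝ E} {t : ℕ} (ht : 1 ≤ t)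
    (hx : x ∈ boundedAway P (explParam P t)) {q : Finset E} (hq : q ∈ P) (c : E → ℝ) :
    stratCost c q = ∑ e, costEstimate x q c e * x e := by
  rw [stratCost_eq_sum]
  refine Finset.sum_congr rfl fun e _ => ?_
  rw [costEstimate_apply, stratVec_apply]
  split_ifs with h
  · have he : e ∈ activeRes P := mem_activeRes.2 ⟨q, hq, h⟩
    have : x e ≠ 0 := ((explParam_pos he ht).trans_le (hx.2 e he)).ne'
    field_simp
  · simp

theorem stratCost_nonneg {F : Type*} {c : F → ℝ} (hc : ∀ e, 0 ≤ c e) (q : Finset F) : 0 ≤ stratCost c q :=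
  Finset.sum_nonneg fun e _ => hc e

theorem stratCost_le {F : Type*} [Fintype F] {c : F → ℝ} {K : ℝ} (hK : 0 ≤ K)
    (hc : ∀ e, c e ≤ K) (q : Finset F) : stratCost c q ≤ Fintype.card F * K := by
  calc stratCost c q ≤ ∑ _e ∈ q, K := Finset.sum_le_sum fun e _ => hc e
    _ = q.card * K := by simp
    _ ≤ _ := mul_le_mul_of_nonneg_right (by exact_mod_cast Finset.card_le_univ _) hK

/-- The error, against the comparator of round `t`, of the cost estimate if `s` is sampled. -/
noncomputable def estimateError (P : Finset (Finset E)) (a : EuclideanSpace ℝ E)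
    (q : Finset E) (t : ℕ) (x : EuclideanSpace ℝ E) (c : E → ℝ) (s : Finset E) : ℝ :=
  ∑ e, (costEstimate x s c e - c e) * comparator P a q t e

theorem abs_estimateError_le {a : EuclideanSpace ℝ E} (ha : a ∈ descPolytope P)
    (ha' : ∀ e ∈ activeRes P, 1 / ((activeRes P).card : ℝ) ≤ a e) {q s : Finset E} (hq : q ∈ P)
    (hs : s ∈ P) {t T : ℕ} (ht : 1 ≤ t) (htT : t ≤ T)
    (hm : (Fintype.card E : ℝ) ≤ (T : ℝ) ^ (1 / 5 : ℝ)) {x : EuclideanSpace ℝ E}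
    (hx : x ∈ boundedAway P (explParam P t)) {c : E → ℝ} {K : ℝ} (hK : 0 ≤ K)
    (hc : ∀ e, 0 ≤ c e ∧ c e ≤ K) :
    |estimateError P a q t x c s| ≤ Fintype.card E * K * (T : ℝ) ^ (1 / 5 : ℝ) := by
  have hr : 1 ≤ (T : ℝ) ^ (1 / 5 : ℝ) :=
    Real.one_le_rpow (by exact_mod_cast (ht.trans htT)) (by norm_num)
  refine (Finset.abs_sum_le_sum_abs _ _).trans ?_
  calc _ ≤ ∑ _e : E, K * (T : ℝ) ^ (1 / 5 : ℝ) := Finset.sum_le_sum fun e _ => by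
        obtain ⟨h1, h2⟩ := costEstimate_bounds ht htT hm hx hs (hc e).1 (hc e).2
        obtain ⟨z0, z1, -⟩ := descPolytope_coord (comparator_mem ha ha' hq t).1 e
        have h3 : K ≤ K * (T : ℝ) ^ (1 / 5 : ℝ) := le_mul_of_one_le_right hK hr
        have h4 : |costEstimate x s c e - c e| ≤ K * (T : ℝ) ^ (1 / 5 : ℝ) :=
          abs_le.2 ⟨by linarith [(hc e).2], by linarith [(hc e).1]⟩
        rw [abs_mul, abs_of_nonneg z0]
        exact mul_le_of_le_one_right (abs_nonneg _) z1 |>.trans h4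
    _ = _ := by simp [mul_assoc]

/-- The estimate is unbiased on active resources. On inactive ones it is 0 whatever the cost, but
there the comparator vanishes. -/
theorem sum_mul_estimateError {a : EuclideanSpace ℝ E} (ha : a ∈ descPolytope P)
    (ha' : ∀ e ∈ activeRes P, 1 / ((activeRes P).card : ℝ) ≤ a e) {q : Finset E} (hq : q ∈ P)
    {t : ℕ} (ht : 1 ≤ t) {x : EuclideanSpace ℝ E}
    (hx : x ∈ boundedAway P (explParam P t)) {w : Finset E → ℝ} (hw : IsCaratheodory P x w)
    (c : E → ℝ) : ∑ s ∈ P, w s * estimateError P a q t x c s = 0 := by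
  simp only [estimateError, Finset.mul_sum]
  rw [Finset.sum_comm]
  refine Finset.sum_eq_zero fun e _ => ?_
  have hz := (descPolytope_coord (comparator_mem ha ha' hq t).1 e).2.2
  generalize comparator P a q t e = z at *
  have h1 : ∀ s ∈ P, w s * ((costEstimate x s c e - c e) * z) =
      (if e ∈ s then w s else 0) * (c e / x e * z) - w s * (c e * z) := by
    intro s _
    rw [costEstimate_apply]
    split_ifs <;> ring
  rw [Finset.sum_congr rfl h1, Finset.sum_sub_distrib, ← Finset.sum_mul, ← Finset.sum_mul,
    hw.sum_eq_one, ← Finset.sum_filter, ← hw.marginal]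
  by_cases he : e ∈ activeRes P
  · have : x e ≠ 0 := ((explParam_pos he ht).trans_le (hx.2 e he)).ne'
    field_simp
    ring
  · rw [hz he]
    ring

theorem sum_mul_comparator_sub_le {a : EuclideanSpace ℝ E} (ha : a ∈ descPolytope P)
    {q : Finset E} (hq : q ∈ P) (t : ℕ) {c : E → ℝ} {K : ℝ} (hK : 0 ≤ K)
    (hc : ∀ e, 0 ≤ c e ∧ c e ≤ K) :
    ∑ e, c e * (comparator P a q t e - stratVec q e) ≤
      (Fintype.card E : ℝ) ^ 2 * K * (t : ℝ) ^ (-(1 / 5) : ℝ) := by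
  calc _ ≤ ∑ _e : E, K * mixWeight P t := Finset.sum_le_sum fun e _ => by
        rw [comparator_apply]
        obtain ⟨a0, a1, -⟩ := descPolytope_coord ha e
        obtain ⟨q0, q1, -⟩ := descPolytope_coord (stratVec_mem_descPolytope hq) e
        have h1 : (1 - mixWeight P t) * stratVec q e + mixWeight P t * a e - stratVec q e =
          mixWeight P t * (a e - stratVec q e) := by ring
        rw [h1]
        exact (mul_le_mul_of_nonneg_left (mul_le_of_le_one_right (mixWeight_nonneg t)
          (by linarith)) (hc e).1).trans
            (mul_le_mul_of_nonneg_right (hc e).2 (mixWeight_nonneg t))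
    _ = Fintype.card E * (K * mixWeight P t) := by simp
    _ ≤ Fintype.card E * (K * (Fintype.card E * (t : ℝ) ^ (-(1 / 5) : ℝ))) := by
        have := mixWeight_le (P := P) t
        gcongr
    _ = _ := by ring

theorem rpow_div_five (T : ℕ) (k : ℕ) : (T : ℝ) ^ ((k : ℝ) / 5) = ((T : ℝ) ^ (1 / 5 : ℝ)) ^ k := by
  rw [← Real.rpow_natCast, ← Real.rpow_mul (Nat.cast_nonneg T)]
  congr 1
  ring

theorem regret_against_le {T : ℕ} (hT : 1 ≤ T)
    (hm : (Fintype.card E : ℝ) ≤ (T : ℝ) ^ (1 / 5 : ℝ))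
    {x : ℕ → EuclideanSpace ℝ E} {p : ℕ → Finset E} {c : ℕ → E → ℝ} {K : ℝ} (hK : 1 ≤ K)
    (hx : ∀ t, 1 ≤ t → t ≤ T → x t ∈ boundedAway P (explParam P t))
    (hp : ∀ t, 1 ≤ t → t ≤ T → p t ∈ P)
    (hc : ∀ t, 1 ≤ t → t ≤ T → ∀ e, 0 ≤ c t e ∧ c t e ≤ K)
    (hup : ∀ t, 1 ≤ t → t < T → IsEuclideanProj (boundedAway P (explParam P (t + 1)))
      (x t - stepSize t • costEstimate (x t) (p t) (c t)) (x (t + 1)))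
    {a : EuclideanSpace ℝ E} (ha : a ∈ descPolytope P)
    (ha' : ∀ e ∈ activeRes P, 1 / ((activeRes P).card : ℝ) ≤ a e) {q : Finset E} (hq : q ∈ P) :
    ∑ t ∈ Finset.Icc 1 T, stratCost (c t) (p t) - ∑ t ∈ Finset.Icc 1 T, stratCost (c t) q ≤
      3 * ((Fintype.card E : ℝ) * K ^ 2 + (Fintype.card E : ℝ) ^ 2 * K) * (T : ℝ) ^ (4 / 5 : ℝ) +
        ∑ t ∈ Finset.Icc 1 T, estimateError P a q t (x t) (c t) (p t) := by
  have hK0 : 0 ≤ K := by linarith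
  have hr1 : 1 ≤ (T : ℝ) ^ (1 / 5 : ℝ) := Real.one_le_rpow (by exact_mod_cast hT) (by norm_num)
  have hgd := gradient_descent_regret (g := fun t => costEstimate (x t) (p t) (c t))
    hT hx hup ha ha' hq
  have hsplit : ∑ t ∈ Finset.Icc 1 T, stratCost (c t) (p t) -
      ∑ t ∈ Finset.Icc 1 T, stratCost (c t) q =
      ∑ t ∈ Finset.Icc 1 T, ∑ e, costEstimate (x t) (p t) (c t) e *
          (x t e - comparator P a q t e) +
        ∑ t ∈ Finset.Icc 1 T, estimateError P a q t (x t) (c t) (p t) +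
        ∑ t ∈ Finset.Icc 1 T, ∑ e, c t e * (comparator P a q t e - stratVec q e) := by
    rw [← Finset.sum_sub_distrib, ← Finset.sum_add_distrib, ← Finset.sum_add_distrib]
    refine Finset.sum_congr rfl fun t ht => ?_
    obtain ⟨h1, h2⟩ := Finset.mem_Icc.1 ht
    rw [stratCost_eq_sum_costEstimate h1 (hx t h1 h2) (hp t h1 h2), stratCost_eq_sum,
      estimateError, ← Finset.sum_sub_distrib, ← Finset.sum_add_distrib,
      ← Finset.sum_add_distrib]
    exact Finset.sum_congr rfl fun e _ => by ring
  have hsq : ∑ t ∈ Finset.Icc 1 T, stepSize t * ∑ e, costEstimate (x t) (p t) (c t) e ^ 2 ≤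
      (T : ℝ) ^ (1 - 3 / 5 : ℝ) / (1 - 3 / 5) *
        (Fintype.card E * (K * (T : ℝ) ^ (1 / 5 : ℝ)) ^ 2) := by
    refine le_trans ?_ (mul_le_mul_of_nonneg_right
      (sum_rpow_neg_le (s := 3 / 5) (by norm_num) (by norm_num) T) (by positivity))
    rw [Finset.sum_mul]
    refine Finset.sum_le_sum fun t ht => ?_
    obtain ⟨h1, h2⟩ := Finset.mem_Icc.1 ht
    refine mul_le_mul_of_nonneg_left ?_ (stepSize_pos h1).le
    calc _ ≤ ∑ _e : E, (K * (T : ℝ) ^ (1 / 5 : ℝ)) ^ 2 := Finset.sum_le_sum fun e _ => by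
          obtain ⟨h3, h4⟩ := costEstimate_bounds h1 h2 hm (hx t h1 h2) (hp t h1 h2)
            (hc t h1 h2 e).1 (hc t h1 h2 e).2
          exact pow_le_pow_left₀ h3 h4 2
      _ = _ := by simp
  have hcmp : ∑ t ∈ Finset.Icc 1 T, ∑ e, c t e * (comparator P a q t e - stratVec q e) ≤
      (Fintype.card E : ℝ) ^ 2 * K * ((T : ℝ) ^ (1 - 1 / 5 : ℝ) / (1 - 1 / 5)) := by
    refine le_trans (Finset.sum_le_sum fun t ht => sum_mul_comparator_sub_le ha hq t hK0
      (hc t (Finset.mem_Icc.1 ht).1 (Finset.mem_Icc.1 ht).2)) ?_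
    rw [← Finset.mul_sum]
    exact mul_le_mul_of_nonneg_left
      (sum_rpow_neg_le (s := 1 / 5) (by norm_num) (by norm_num) T) (by positivity)
  rw [← Finset.mul_sum] at hgd
  have e2 := rpow_div_five T 2
  have e3 := rpow_div_five T 3
  have e4 := rpow_div_five T 4
  rw [hsplit]
  norm_num only [Nat.cast_ofNat] at e2 e3 e4 hsq hcmp
  rw [e2] at hsq
  rw [e3] at hgd
  rw [e4] at hcmp ⊢
  generalize (T : ℝ) ^ (1 / 5 : ℝ) = r at *
  have hm0 : (0 : ℝ) ≤ Fintype.card E := Nat.cast_nonneg _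
  have h34 : r ^ 3 ≤ r ^ 4 := pow_le_pow_right₀ hr1 (by norm_num)
  have hK2 : 1 ≤ K ^ 2 := one_le_pow₀ hK
  have hr4 : 0 ≤ r ^ 4 := by positivity
  have hA : Fintype.card E * r ^ 3 ≤ Fintype.card E * K ^ 2 * r ^ 4 := by
    rw [mul_assoc]
    exact mul_le_mul_of_nonneg_left (h34.trans (le_mul_of_one_le_left hr4 hK2)) hm0
  have hA0 : 0 ≤ Fintype.card E * K ^ 2 * r ^ 4 := by positivity
  have hB0 : 0 ≤ (Fintype.card E : ℝ) ^ 2 * K * r ^ 4 := by positivity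
  -- After halving `hgd`, mK²r⁴ has coefficient 3/2 + 5/4 and m²Kr⁴ has 5/4, both below 3.
  ring_nf at hA hA0 hB0 hgd hsq hcmp ⊢
  linarith

end Run

/-! ### Regret with high probability and in expectation -/

section Regret

variable {E : Type*} {P : Finset (Finset E)} {hP : P.Nonempty} {T : ℕ} {K : ℝ}

theorem bestFixedCost_nonneg {c : ℕ → E → ℝ}
    (hc : ∀ t, 1 ≤ t → t ≤ T → ∀ e, 0 ≤ c t e ∧ c t e ≤ K) : 0 ≤ bestFixedCost P hP T c :=
  Finset.le_inf' hP _ fun q _ => Finset.sum_nonneg fun t ht =>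
    stratCost_nonneg (fun e => (hc t (Finset.mem_Icc.1 ht).1 (Finset.mem_Icc.1 ht).2 e).1) q

theorem exists_bestFixedCost_eq (c : ℕ → E → ℝ) :
    ∃ q ∈ P, bestFixedCost P hP T c = ∑ t ∈ Finset.Icc 1 T, stratCost (c t) q :=
  Finset.exists_mem_eq_inf' hP _

variable [Fintype E]

theorem sum_stratCost_le {p : ℕ → Finset E} {c : ℕ → E → ℝ} (hK : 0 ≤ K)
    (hc : ∀ t, 1 ≤ t → t ≤ T → ∀ e, 0 ≤ c t e ∧ c t e ≤ K) :
    ∑ t ∈ Finset.Icc 1 T, stratCost (c t) (p t) ≤ T * (Fintype.card E * K) := by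
  calc _ ≤ ∑ _t ∈ Finset.Icc 1 T, (Fintype.card E * K : ℝ) := Finset.sum_le_sum fun t ht =>
        stratCost_le hK (fun e => (hc t (Finset.mem_Icc.1 ht).1 (Finset.mem_Icc.1 ht).2 e).2) _
    _ = _ := by simp

theorem bestFixedCost_le {c : ℕ → E → ℝ} (hK : 0 ≤ K)
    (hc : ∀ t, 1 ≤ t → t ≤ T → ∀ e, 0 ≤ c t e ∧ c t e ≤ K) :
    bestFixedCost P hP T c ≤ T * (Fintype.card E * K) := by
  obtain ⟨q, hq⟩ := hP
  exact (Finset.inf'_le _ hq).trans (sum_stratCost_le (p := fun _ => q) hK hc)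

theorem card_strategies_le (P : Finset (Finset E)) : (P.card : ℝ) ≤ 2 ^ Fintype.card E := by
  exact_mod_cast (Finset.card_le_univ P).trans (by simp)

/-- Short horizons: T = r⁵ ≤ m r⁴, so the trivial regret bound suffices. The case m = 0 is included
because the exponential-moment argument divides by m. -/
theorem card_mul_le_of_pow_le (h : (T : ℝ) ^ (1 / 5 : ℝ) ≤ Fintype.card E ∨ Fintype.card E = 0) :
    T * (Fintype.card E : ℝ) ≤ (Fintype.card E : ℝ) ^ 2 * (T : ℝ) ^ (4 / 5 : ℝ) := by
  rcases h with h | h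
  · have e4 := rpow_div_five T 4
    have e5 := rpow_div_five T 5
    norm_num only [Nat.cast_ofNat, Real.rpow_one] at e4 e5
    rw [e4]
    nth_rewrite 1 [e5]
    have hr : 0 ≤ (T : ℝ) ^ (1 / 5 : ℝ) := by positivity
    generalize (T : ℝ) ^ (1 / 5 : ℝ) = r at *
    have := mul_le_mul_of_nonneg_left h
      (by positivity : (0 : ℝ) ≤ Fintype.card E * r ^ 4)
    linarith
  · simp [h]

variable [DecidableEq E]

theorem sum_mul_stratCost_bounds {x : EuclideanSpace ℝ E} {w : Finset E → ℝ} {c : E → ℝ}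
    (hK : 0 ≤ K) (hc : ∀ e, 0 ≤ c e ∧ c e ≤ K) (hw : IsCaratheodory P x w) :
    0 ≤ ∑ q ∈ P, w q * stratCost c q ∧
      ∑ q ∈ P, w q * stratCost c q ≤ Fintype.card E * K := by
  refine ⟨Finset.sum_nonneg fun q _ =>
    mul_nonneg (hw.nonneg q) (stratCost_nonneg (fun e => (hc e).1) q), ?_⟩
  calc _ ≤ ∑ q ∈ P, w q * (Fintype.card E * K) := Finset.sum_le_sum fun q _ =>
        mul_le_mul_of_nonneg_left (stratCost_le hK (fun e => (hc e).2) q) (hw.nonneg q)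
    _ = _ := by rw [← Finset.sum_mul, hw.sum_eq_one, one_mul]

variable {Ω : Type*} {mΩ : MeasurableSpace Ω} {Pr : Measure Ω}
  {ℱ : Filtration ℕ mΩ} {x : ℕ → Ω → EuclideanSpace ℝ E} {w : ℕ → Ω → Finset E → ℝ}
  {p : ℕ → Ω → Finset E} {c : ℕ → Ω → E → ℝ}

theorem IsSBGDCERun.mem_boundedAway (h : IsSBGDCERun P T Pr ℱ x w p c) {t : ℕ} (ht : 1 ≤ t)
    (htT : t ≤ T) (ω : Ω) : x t ω ∈ boundedAway P (explParam P t) := by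
  rcases ht.eq_or_lt with rfl | h1
  · exact h.init htT ω
  · obtain ⟨s, rfl⟩ : ∃ s, t = s + 1 := ⟨t - 1, by omega⟩
    exact (h.update s (by omega) (by omega) ω).1

theorem IsSBGDCERun.measurable_stratCost (h : IsSBGDCERun P T Pr ℱ x w p c) {t : ℕ}
    (ht : 1 ≤ t) (htT : t ≤ T) (q : Finset E) :
    Measurable[ℱ t] (fun ω => stratCost (c t ω) q) :=
  Finset.measurable_fun_sum _ fun e _ => h.meas_c t ht htT e

theorem IsSBGDCERun.realizedRegret_le (h : IsSBGDCERun P T Pr ℱ x w p c) (hT : 1 ≤ T)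
    (hm : (Fintype.card E : ℝ) ≤ (T : ℝ) ^ (1 / 5 : ℝ)) (hK : 1 ≤ K)
    (hc : ∀ t, 1 ≤ t → t ≤ T → ∀ ω e, 0 ≤ c t ω e ∧ c t ω e ≤ K)
    {a : EuclideanSpace ℝ E} (ha : a ∈ descPolytope P)
    (ha' : ∀ e ∈ activeRes P, 1 / ((activeRes P).card : ℝ) ≤ a e) (ω : Ω) :
    ∃ q ∈ P, realizedRegret P hP T (fun t => p t ω) (fun t => c t ω) ≤
      3 * ((Fintype.card E : ℝ) * K ^ 2 + (Fintype.card E : ℝ) ^ 2 * K) * (T : ℝ) ^ (4 / 5 : ℝ) +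
        ∑ t ∈ Finset.Icc 1 T, estimateError P a q t (x t ω) (c t ω) (p t ω) := by
  obtain ⟨q, hq, hbest⟩ := exists_bestFixedCost_eq (hP := hP) (T := T) (fun t => c t ω)
  refine ⟨q, hq, ?_⟩
  rw [realizedRegret, hbest]
  exact regret_against_le hT hm hK (fun t h1 h2 => h.mem_boundedAway h1 h2 ω)
    (fun t h1 h2 => h.p_mem t h1 h2 ω) (fun t h1 h2 => hc t h1 h2 ω)
    (fun t h1 h2 => h.update t h1 h2 ω) ha ha' hq

variable [IsProbabilityMeasure Pr]

theorem IsSBGDCERun.integral_exp_estimateError (h : IsSBGDCERun P T Pr ℱ x w p c)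
    (hm0 : 0 < Fintype.card E) (hm : (Fintype.card E : ℝ) ≤ (T : ℝ) ^ (1 / 5 : ℝ)) (hK : 0 < K)
    (hc : ∀ t, 1 ≤ t → t ≤ T → ∀ ω e, 0 ≤ c t ω e ∧ c t ω e ≤ K)
    {a : EuclideanSpace ℝ E} (ha : a ∈ descPolytope P)
    (ha' : ∀ e ∈ activeRes P, 1 / ((activeRes P).card : ℝ) ≤ a e) {q : Finset E} (hq : q ∈ P)
    (θ : ℝ) :
    Integrable (fun ω => Real.exp (θ * ∑ t ∈ Finset.Icc 1 T,
      estimateError P a q t (x t ω) (c t ω) (p t ω))) Pr ∧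
      ∫ ω, Real.exp (θ * ∑ t ∈ Finset.Icc 1 T,
        estimateError P a q t (x t ω) (c t ω) (p t ω)) ∂Pr ≤
        Real.exp (T * ((θ * (Fintype.card E * K * (T : ℝ) ^ (1 / 5 : ℝ))) ^ 2 / 2)) := by
  have hm0' : (0 : ℝ) < Fintype.card E := by exact_mod_cast hm0
  have hB : 0 < Fintype.card E * K * (T : ℝ) ^ (1 / 5 : ℝ) :=
    mul_pos (mul_pos hm0' hK) (hm0'.trans_le hm)
  refine (integral_exp_sampled_sum_le (P := P) (T := T) (ℱ := ℱ) (p := p) (w := w)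
    (y := fun t s ω => estimateError P a q t (x t ω) (c t ω) s) θ hB h.p_mem h.meas_p h.sample
    (fun t h1 h2 ω => (h.decomp t h1 h2 ω).nonneg)
    (fun t h1 h2 ω => (h.decomp t h1 h2 ω).sum_eq_one) (fun t h1 h2 s => ?_)
    (fun t h1 h2 s hs ω => abs_estimateError_le ha ha' hq hs h1 h2 hm
      (h.mem_boundedAway h1 h2 ω) hK.le (hc t h1 h2 ω))
    (fun t h1 h2 ω => sum_mul_estimateError ha ha' hq h1 (h.mem_boundedAway h1 h2 ω)
      (h.decomp t h1 h2 ω) _) le_rfl).2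
  refine Finset.measurable_fun_sum _ fun e _ => Measurable.mul_const ?_ _
  simp only [costEstimate_apply]
  exact (((h.meas_c t h1 h2 e).mul_const _).div (h.meas_x t h1 h2 e)).sub (h.meas_c t h1 h2 e)

theorem IsSBGDCERun.integral_stratCost (h : IsSBGDCERun P T Pr ℱ x w p c) (hK : 0 ≤ K)
    (hc : ∀ t, 1 ≤ t → t ≤ T → ∀ ω e, 0 ≤ c t ω e ∧ c t ω e ≤ K) {t : ℕ} (h1 : 1 ≤ t)
    (h2 : t ≤ T) :
    Integrable (fun ω => stratCost (c t ω) (p t ω)) Pr ∧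
      Integrable (fun ω => ∑ q ∈ P, w t ω q * stratCost (c t ω) q) Pr ∧
      ∫ ω, stratCost (c t ω) (p t ω) ∂Pr = ∫ ω, ∑ q ∈ P, w t ω q * stratCost (c t ω) q ∂Pr :=
  integral_sampled (h := fun q ω => stratCost (c t ω) q) (K := Fintype.card E * K) (ℱ.le t)
    (h.p_mem t h1 h2) (fun q => ℱ.le _ _ (h.meas_p t h1 h2 q)) (h.sample t h1 h2)
    (fun q _ => h.measurable_stratCost h1 h2 q) fun q _ ω => by
      rw [abs_of_nonneg (stratCost_nonneg (fun e => (hc t h1 h2 ω e).1) q)]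
      exact stratCost_le hK (fun e => (hc t h1 h2 ω e).2) q

theorem IsSBGDCERun.integrable_mixedRegret (h : IsSBGDCERun P T Pr ℱ x w p c) (hK : 0 ≤ K)
    (hc : ∀ t, 1 ≤ t → t ≤ T → ∀ ω e, 0 ≤ c t ω e ∧ c t ω e ≤ K) :
    Integrable (fun ω => mixedRegret P hP T (fun t => w t ω) (fun t => c t ω)) Pr := by
  refine Integrable.sub (integrable_finsetSum _ fun t ht => (h.integral_stratCost hK hc
    (Finset.mem_Icc.1 ht).1 (Finset.mem_Icc.1 ht).2).2.1) ?_
  have hmeas : Measurable (fun ω => bestFixedCost P hP T (fun t => c t ω)) := by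
    have hinf : (fun ω => bestFixedCost P hP T (fun t => c t ω)) =
        P.inf' hP fun q ω => ∑ t ∈ Finset.Icc 1 T, stratCost (c t ω) q := by
      funext ω
      rw [Finset.inf'_apply]
      rfl
    rw [hinf]
    refine Finset.inf'_induction hP _ (p := fun f : Ω → ℝ => Measurable f)
      (fun f hf g hg => hf.inf hg) fun q _ => ?_
    exact Finset.measurable_fun_sum _ fun t ht => (h.measurable_stratCost
      (Finset.mem_Icc.1 ht).1 (Finset.mem_Icc.1 ht).2 q).mono (ℱ.le t) le_rfl
  refine Integrable.of_bound hmeas.aestronglyMeasurable (T * (Fintype.card E * K))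
    (Filter.Eventually.of_forall fun ω => ?_)
  have hcω := fun t h1 h2 => hc t h1 h2 ω
  rw [Real.norm_eq_abs, abs_of_nonneg (bestFixedCost_nonneg hcω)]
  exact bestFixedCost_le hK hcω

theorem IsSBGDCERun.measureReal_estimateError_ge (h : IsSBGDCERun P T Pr ℱ x w p c)
    (hm0 : 0 < Fintype.card E) (hm : (Fintype.card E : ℝ) ≤ (T : ℝ) ^ (1 / 5 : ℝ)) (hK : 0 < K)
    (hc : ∀ t, 1 ≤ t → t ≤ T → ∀ ω e, 0 ≤ c t ω e ∧ c t ω e ≤ K)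
    {a : EuclideanSpace ℝ E} (ha : a ∈ descPolytope P)
    (ha' : ∀ e ∈ activeRes P, 1 / ((activeRes P).card : ℝ) ≤ a e) {θ : ℝ} (hθ : 0 ≤ θ) (s : ℝ) :
    Pr.real (⋃ q ∈ P, {ω | s ≤ ∑ t ∈ Finset.Icc 1 T,
        estimateError P a q t (x t ω) (c t ω) (p t ω)}) ≤
      2 ^ Fintype.card E * Real.exp
        (T * ((θ * (Fintype.card E * K * (T : ℝ) ^ (1 / 5 : ℝ))) ^ 2 / 2) - θ * s) := by
  refine (measureReal_biUnion_finset_le _ _).trans ?_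
  calc _ ≤ ∑ _q ∈ P, Real.exp
        (T * ((θ * (Fintype.card E * K * (T : ℝ) ^ (1 / 5 : ℝ))) ^ 2 / 2) - θ * s) :=
        Finset.sum_le_sum fun q hq => by
          obtain ⟨hi, hle⟩ := h.integral_exp_estimateError hm0 hm hK hc ha ha' hq θ
          refine (ProbabilityTheory.measure_ge_le_exp_mul_mgf s hθ hi).trans ?_
          rw [sub_eq_add_neg, Real.exp_add, mul_comm, neg_mul]
          exact mul_le_mul_of_nonneg_right hle (Real.exp_pos _).le
    _ ≤ _ := by
      rw [Finset.sum_const, nsmul_eq_mul]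
      exact mul_le_mul_of_nonneg_right (card_strategies_le P) (Real.exp_pos _).le

theorem IsSBGDCERun.realizedRegret_tail (h : IsSBGDCERun P T Pr ℱ x w p c) (hK : 1 ≤ K)
    (hc : ∀ t, 1 ≤ t → t ≤ T → ∀ ω e, 0 ≤ c t ω e ∧ c t ω e ≤ K) {δ : ℝ} (hδ : 0 < δ)
    (hδ2 : δ ≤ 1 / 2) :
    1 - δ ≤ Pr.real {ω | realizedRegret P hP T (fun t => p t ω) (fun t => c t ω) ≤
      9 * ((Fintype.card E : ℝ) * K ^ 2 + (Fintype.card E : ℝ) ^ 2 * K)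
        * (T : ℝ) ^ (4 / 5 : ℝ) * Real.log (1 / δ)} := by
  have hK0 : 0 < K := by linarith
  have hL : 1 / 2 ≤ Real.log (1 / δ) := by
    have h2 : Real.log 2 ≤ Real.log (1 / δ) :=
      Real.log_le_log (by norm_num) (by rw [le_div_iff₀ hδ]; linarith)
    linarith [Real.log_two_gt_d9]
  have hr4 : 0 ≤ (T : ℝ) ^ (4 / 5 : ℝ) := by positivity
  have hA0 : 0 ≤ (Fintype.card E : ℝ) * K ^ 2 := by positivity
  by_cases htriv : (T : ℝ) ^ (1 / 5 : ℝ) ≤ Fintype.card E ∨ Fintype.card E = 0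
  · have hall : {ω | realizedRegret P hP T (fun t => p t ω) (fun t => c t ω) ≤
        9 * ((Fintype.card E : ℝ) * K ^ 2 + (Fintype.card E : ℝ) ^ 2 * K)
          * (T : ℝ) ^ (4 / 5 : ℝ) * Real.log (1 / δ)} = Set.univ := by
      refine Set.eq_univ_of_forall fun ω => ?_
      have hcω := fun t h1 h2 => hc t h1 h2 ω
      have h1 := sum_stratCost_le (p := fun t => p t ω) hK0.le hcω
      have h2 := bestFixedCost_nonneg (hP := hP) hcω
      have h3 := mul_le_mul_of_nonneg_right (card_mul_le_of_pow_le htriv) hK0.le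
      have h4 : 0 ≤ (Fintype.card E : ℝ) ^ 2 * K * (T : ℝ) ^ (4 / 5 : ℝ) := by positivity
      have h5 := mul_nonneg hA0 hr4
      have h6 := mul_le_mul_of_nonneg_left hL (add_nonneg h5 h4)
      show realizedRegret _ _ _ _ _ ≤ _
      unfold realizedRegret
      linarith
    rw [hall, probReal_univ]
    linarith
  push Not at htriv
  obtain ⟨hm, hm0⟩ := htriv
  obtain ⟨a, ha, ha'⟩ := exists_interior_point hP
  have hm0' : 0 < Fintype.card E := Nat.pos_of_ne_zero hm0
  have hm1 : (1 : ℝ) ≤ Fintype.card E := by exact_mod_cast hm0'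
  have hT : 1 ≤ T := by
    rcases Nat.eq_zero_or_pos T with rfl | hT
    · norm_num at hm; linarith
    · exact hT
  have e4 := rpow_div_five T 4
  have e5 := rpow_div_five T 5
  norm_num only [Nat.cast_ofNat, Real.rpow_one] at e4 e5
  set r := (T : ℝ) ^ (1 / 5 : ℝ) with hr
  set m : ℝ := (Fintype.card E : ℝ) with hmdef
  set L := Real.log (1 / δ) with hLdef
  have hr1 : 1 ≤ r := hm1.trans hm.le
  -- With θ = 1/(r³mK) and T = r⁵ the variance term of the exponent is r/2. The r/2 in `s` cancels
  -- it, and (m+1)L leaves 2^m δ^(m+1) ≤ δ, as δ ≤ 1/2.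
  set s := ((m + 1) * L + r / 2) * (r ^ 3 * m * K) with hs
  have hbad := h.measureReal_estimateError_ge hm0' hm.le hK0 hc ha ha'
    (θ := 1 / (r ^ 3 * m * K)) (by positivity) s
  have hsle : s ≤ 3 * m ^ 2 * K * r ^ 4 * L := by
    have h1 : (m + 1) * L + r / 2 ≤ 3 * m * r * L := by
      have : 1 ≤ m * r := one_le_mul_of_one_le_of_one_le hm1 hr1
      nlinarith [mul_le_mul_of_nonneg_right hr1 (by positivity : (0 : ℝ) ≤ m * L),
        mul_le_mul_of_nonneg_right this (by linarith : (0 : ℝ) ≤ L),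
        mul_le_mul_of_nonneg_right hm1 (by positivity : (0 : ℝ) ≤ r * L),
        mul_le_mul_of_nonneg_left hL (by positivity : (0 : ℝ) ≤ r)]
    refine (mul_le_mul_of_nonneg_right h1 (by positivity)).trans (le_of_eq (by ring))
  have hexp : (2 : ℝ) ^ Fintype.card E * Real.exp (T * ((1 / (r ^ 3 * m * K) * (m * K * r)) ^ 2 / 2)
      - 1 / (r ^ 3 * m * K) * s) ≤ δ := by
    have harg : (T : ℝ) * ((1 / (r ^ 3 * m * K) * (m * K * r)) ^ 2 / 2)
        - 1 / (r ^ 3 * m * K) * s = ((Fintype.card E + 1 : ℕ) : ℝ) * Real.log δ := by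
      have hr0 : r ≠ 0 := by positivity
      have hm' : m ≠ 0 := by positivity
      have hLd : L = - Real.log δ := by rw [hLdef, one_div, Real.log_inv]
      rw [e5, hs, hLd]
      push_cast
      rw [← hmdef]
      field_simp
      ring
    rw [harg, Real.exp_nat_mul, Real.exp_log hδ, pow_succ, ← mul_assoc, ← mul_pow]
    exact mul_le_of_le_one_left hδ.le (pow_le_one₀ (by positivity) (by linarith))
  have hmeas : NullMeasurableSet (⋃ q ∈ P, {ω | s ≤ ∑ t ∈ Finset.Icc 1 T,
        estimateError P a q t (x t ω) (c t ω) (p t ω)}) Pr := by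
    refine Finset.nullMeasurableSet_biUnion _ fun q hq => ?_
    -- A.e. measurability of the error sum is recovered as the logarithm of its integrable
    -- exponential.
    have hi := (h.integral_exp_estimateError hm0' hm.le hK0 hc ha ha' hq 1).1
    have := (Real.measurable_log.comp_aemeasurable hi.aemeasurable)
    simp only [Function.comp_def, Real.log_exp, one_mul] at this
    exact nullMeasurableSet_le aemeasurable_const this
  have hcompl := probReal_compl_eq_one_sub₀ hmeas
  refine le_trans (le_trans ?_ hcompl.ge) (measureReal_mono ?_)
  · linarith
  intro ω hω
  simp only [Set.mem_compl_iff, Set.mem_iUnion, not_exists, Set.mem_ofPred_eq, not_le] at hω ⊢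
  obtain ⟨q, hq, hle⟩ := h.realizedRegret_le (hP := hP) hT hm.le hK hc ha ha' ω
  refine hle.trans ?_
  have h1 := hω q hq
  rw [e4]
  -- As 1 ≤ 2L, the pathwise constant 3 becomes 6L; the 3L from `hsle` brings it to 9L.
  have h5 := mul_le_mul_of_nonneg_left hL (by positivity : 0 ≤ (m * K ^ 2 + m ^ 2 * K) * r ^ 4)
  have h6 : 0 ≤ m * K ^ 2 * r ^ 4 * L := by positivity
  linarith

theorem IsSBGDCERun.integral_mixedRegret_le (h : IsSBGDCERun P T Pr ℱ x w p c) (hK : 1 ≤ K)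
    (hc : ∀ t, 1 ≤ t → t ≤ T → ∀ ω e, 0 ≤ c t ω e ∧ c t ω e ≤ K) :
    ∫ ω, mixedRegret P hP T (fun t => w t ω) (fun t => c t ω) ∂Pr ≤
      9 * (Fintype.card E : ℝ) ^ 2 * K ^ 2 * (T : ℝ) ^ (4 / 5 : ℝ) := by
  have hK0 : 0 < K := by linarith
  have hKK : K ≤ K ^ 2 := le_self_pow₀ hK (by norm_num)
  have hint := h.integrable_mixedRegret (hP := hP) hK0.le hc
  by_cases htriv : (T : ℝ) ^ (1 / 5 : ℝ) ≤ Fintype.card E ∨ Fintype.card E = 0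
  · have hpt : ∀ ω, mixedRegret P hP T (fun t => w t ω) (fun t => c t ω) ≤
        9 * (Fintype.card E : ℝ) ^ 2 * K ^ 2 * (T : ℝ) ^ (4 / 5 : ℝ) := by
      intro ω
      have hcω := fun t h1 h2 => hc t h1 h2 ω
      have h1 : ∑ t ∈ Finset.Icc 1 T, ∑ q ∈ P, w t ω q * stratCost (c t ω) q ≤
          T * (Fintype.card E * K) := by
        calc _ ≤ ∑ _t ∈ Finset.Icc 1 T, (Fintype.card E * K : ℝ) :=
              Finset.sum_le_sum fun t ht => by
                obtain ⟨h1, h2⟩ := Finset.mem_Icc.1 ht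
                exact (sum_mul_stratCost_bounds hK0.le (hcω t h1 h2) (h.decomp t h1 h2 ω)).2
          _ = _ := by simp
      have h2 := bestFixedCost_nonneg (hP := hP) hcω
      have h3 := mul_le_mul_of_nonneg_right (card_mul_le_of_pow_le htriv) hK0.le
      have h4 : 0 ≤ (Fintype.card E : ℝ) ^ 2 * (T : ℝ) ^ (4 / 5 : ℝ) := by positivity
      have h5 := mul_le_mul_of_nonneg_left hKK h4
      have h6 : 0 ≤ (Fintype.card E : ℝ) ^ 2 * (T : ℝ) ^ (4 / 5 : ℝ) * K ^ 2 := by positivity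
      unfold mixedRegret
      linarith
    refine (integral_mono hint (integrable_const _) hpt).trans (by simp)
  push Not at htriv
  obtain ⟨hm, hm0⟩ := htriv
  obtain ⟨a, ha, ha'⟩ := exists_interior_point hP
  have hm0' : 0 < Fintype.card E := Nat.pos_of_ne_zero hm0
  have hm1 : (1 : ℝ) ≤ Fintype.card E := by exact_mod_cast hm0'
  have hT : 1 ≤ T := by
    rcases Nat.eq_zero_or_pos T with rfl | hT
    · norm_num at hm; linarith
    · exact hT
  have e4 := rpow_div_five T 4
  have e5 := rpow_div_five T 5
  norm_num only [Nat.cast_ofNat, Real.rpow_one] at e4 e5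
  have hreal := h.realizedRegret_le (hP := hP) hT hm.le hK hc ha ha'
  set S : Finset E → Ω → ℝ := fun q ω => ∑ t ∈ Finset.Icc 1 T,
    estimateError P a q t (x t ω) (c t ω) (p t ω) with hS
  have hmgf := fun q hq θ => h.integral_exp_estimateError hm0' hm.le hK0 hc ha ha' (q := q) hq θ
  rw [e4] at hreal ⊢
  set r := (T : ℝ) ^ (1 / 5 : ℝ) with hr
  set m : ℝ := (Fintype.card E : ℝ) with hmdef
  have hr1 : 1 ≤ r := hm1.trans hm.le
  set V := r ^ 3 * m * K with hV
  have hVpos : 0 < V := by positivity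
  -- Chosen so that exp(-b) cancels the bound 2^m exp(r/2) on the summed exponential moments.
  set b := m * Real.log 2 + r / 2 with hb
  set D : ℝ := 3 * (m * K ^ 2 + m ^ 2 * K) * r ^ 4 with hD
  set M : Ω → ℝ := fun ω => ∑ t ∈ Finset.Icc 1 T,
    (∑ q ∈ P, w t ω q * stratCost (c t ω) q - stratCost (c t ω) (p t ω)) with hM
  have hMi : Integrable M Pr := integrable_finsetSum _ fun t ht => by
    obtain ⟨h1, h2, -⟩ := h.integral_stratCost hK0.le hc (Finset.mem_Icc.1 ht).1
      (Finset.mem_Icc.1 ht).2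
    exact h2.sub h1
  have hM0 : ∫ ω, M ω ∂Pr = 0 := by
    have hcost := fun t ht => h.integral_stratCost hK0.le hc (t := t) (Finset.mem_Icc.1 ht).1
      (Finset.mem_Icc.1 ht).2
    have hsub : ∀ t ∈ Finset.Icc 1 T, Integrable (fun ω =>
        ∑ q ∈ P, w t ω q * stratCost (c t ω) q - stratCost (c t ω) (p t ω)) Pr :=
      fun t ht => (hcost t ht).2.1.sub (hcost t ht).1
    simp only [hM]
    rw [integral_finsetSum _ hsub]
    refine Finset.sum_eq_zero fun t ht => ?_
    obtain ⟨h1, h2, h3⟩ := hcost t ht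
    rw [integral_sub h2 h1, h3, sub_self]
  have hWi : Integrable (fun ω => ∑ q ∈ P, Real.exp (1 / V * S q ω)) Pr :=
    integrable_finsetSum _ fun q hq => (hmgf q hq _).1
  have hW : Real.exp (-b) * ∫ ω, ∑ q ∈ P, Real.exp (1 / V * S q ω) ∂Pr ≤ 1 := by
    rw [integral_finsetSum _ fun q hq => (hmgf q hq _).1]
    have harg : (T : ℝ) * ((1 / V * (m * K * r)) ^ 2 / 2) = r / 2 := by
      have hr0 : r ≠ 0 := by positivity
      have hm' : m ≠ 0 := by positivity
      rw [e5, hV]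
      field_simp
    have hexpb : Real.exp (-b) * (2 ^ Fintype.card E * Real.exp (r / 2)) = 1 := by
      rw [hb, hmdef, ← Real.exp_log (show (0 : ℝ) < 2 ^ Fintype.card E by positivity),
        Real.log_pow, ← Real.exp_add, ← Real.exp_add]
      simp
    refine le_trans (mul_le_mul_of_nonneg_left ?_ (Real.exp_pos _).le) hexpb.le
    calc _ ≤ ∑ _q ∈ P, Real.exp (r / 2) := Finset.sum_le_sum fun q hq => by
          rw [← harg]; exact (hmgf q hq (1 / V)).2
      _ ≤ _ := by
        rw [Finset.sum_const, nsmul_eq_mul]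
        exact mul_le_mul_of_nonneg_right (card_strategies_le P) (Real.exp_pos _).le
  have hpt : ∀ ω, mixedRegret P hP T (fun t => w t ω) (fun t => c t ω) ≤
      M ω + (D + V * (b - 1)) + V * Real.exp (-b) * ∑ q ∈ P, Real.exp (1 / V * S q ω) := by
    intro ω
    obtain ⟨q, hq, hle⟩ := hreal ω
    have h1 : mixedRegret P hP T (fun t => w t ω) (fun t => c t ω) =
        M ω + realizedRegret P hP T (fun t => p t ω) (fun t => c t ω) := by
      simp only [mixedRegret, realizedRegret, hM, Finset.sum_sub_distrib]
      ring
    -- The tangent inequality y + 1 ≤ exp y, followed by summing over all strategies, bounds the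
    -- error at the random best `q` without integrating a tail.
    have h2 := Real.add_one_le_exp (1 / V * S q ω - b)
    have h3 : Real.exp (1 / V * S q ω) ≤ ∑ q ∈ P, Real.exp (1 / V * S q ω) :=
      Finset.single_le_sum (f := fun q => Real.exp (1 / V * S q ω))
        (fun q _ => (Real.exp_pos _).le) hq
    have h4 := mul_le_mul_of_nonneg_left h3 (mul_nonneg hVpos.le (Real.exp_pos (-b)).le)
    rw [sub_eq_add_neg, Real.exp_add] at h2
    have h5 := mul_le_mul_of_nonneg_left h2 hVpos.le
    have h6 : V * (1 / V * S q ω + -b + 1) = S q ω - V * (b - 1) := by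
      field_simp
      ring
    rw [h1]
    linarith
  have hMD : Integrable (fun ω => M ω + (D + V * (b - 1))) Pr := hMi.add (integrable_const _)
  have hVWi : Integrable (fun ω => V * Real.exp (-b) * ∑ q ∈ P, Real.exp (1 / V * S q ω)) Pr :=
    hWi.const_mul _
  have hsum : ∫ ω, (M ω + (D + V * (b - 1)) +
      V * Real.exp (-b) * ∑ q ∈ P, Real.exp (1 / V * S q ω)) ∂Pr =
      D + V * (b - 1) + V * (Real.exp (-b) * ∫ ω, ∑ q ∈ P, Real.exp (1 / V * S q ω) ∂Pr) := by
    rw [integral_add hMD hVWi,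
      integral_add hMi (integrable_const _), hM0, integral_const_mul, integral_const]
    simp [mul_assoc]
  have hVW := mul_le_mul_of_nonneg_left hW hVpos.le
  have hVb : V * b ≤ 2 * m ^ 2 * K * r ^ 4 := by
    have hb2 : b ≤ 2 * m * r := by
      have hl : m * Real.log 2 ≤ m * r :=
        mul_le_mul_of_nonneg_left (by linarith [Real.log_two_lt_d9]) (by positivity)
      have hl2 : 1 * r ≤ m * r := mul_le_mul_of_nonneg_right hm1 (by positivity)
      rw [hb]
      linarith
    refine (mul_le_mul_of_nonneg_left hb2 hVpos.le).trans (le_of_eq (by rw [hV]; ring))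
  have hmm : m ≤ m ^ 2 := le_self_pow₀ hm1 (by norm_num)
  have h7 : m * K ^ 2 * r ^ 4 ≤ m ^ 2 * K ^ 2 * r ^ 4 := by gcongr
  have h8 : m ^ 2 * K * r ^ 4 ≤ m ^ 2 * K ^ 2 * r ^ 4 := by gcongr
  have h9 : 0 ≤ m ^ 2 * K ^ 2 * r ^ 4 := by positivity
  -- The expectation is at most D + Vb, with D ≤ 6m²K²r⁴ and Vb ≤ 2m²K²r⁴, so 8 would suffice; 9
  -- matches the tail bound.
  refine (integral_mono hint (hMD.add hVWi) hpt).trans (hsum.le.trans ?_)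
  linarith

end Regret

theorem theorem3p6 :
    ∃ C : ℝ, 0 < C ∧
      ∀ (E : Type*) [Fintype E] [DecidableEq E] (P : Finset (Finset E)) (hP : P.Nonempty)
        (T : ℕ) (cmax : ℝ) (_ : 1 ≤ cmax)
        (Ω : Type*) (mΩ : MeasurableSpace Ω) (Pr : Measure Ω) [IsProbabilityMeasure Pr]
        (ℱ : Filtration ℕ mΩ) (x : ℕ → Ω → EuclideanSpace ℝ E) (w : ℕ → Ω → Finset E → ℝ)
        (p : ℕ → Ω → Finset E) (c : ℕ → Ω → E → ℝ)
        (_ : IsSBGDCERun P T Pr ℱ x w p c)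
        (_ : ∀ t, 1 ≤ t → t ≤ T → ∀ ω, (∀ e, 0 ≤ c t ω e) ∧ ‖c t ω‖ ≤ cmax),
        (∀ δ : ℝ, 0 < δ → δ ≤ 1 / 2 →
          1 - δ ≤ Pr.real {ω | realizedRegret P hP T (fun t => p t ω) (fun t => c t ω) ≤
            C * ((Fintype.card E : ℝ) * cmax ^ 2 + (Fintype.card E : ℝ) ^ 2 * cmax)
              * (T : ℝ) ^ (4 / 5 : ℝ) * Real.log (1 / δ)}) ∧
        Integrable (fun ω => mixedRegret P hP T (fun t => w t ω) (fun t => c t ω)) Pr ∧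
        ∫ ω, mixedRegret P hP T (fun t => w t ω) (fun t => c t ω) ∂Pr ≤
          C * (Fintype.card E : ℝ) ^ 2 * cmax ^ 2 * (T : ℝ) ^ (4 / 5 : ℝ) := by
  refine ⟨9, by norm_num, ?_⟩
  intro E _ _ P hP T K hK Ω mΩ Pr _ ℱ x w p c hrun hcost
  have hc : ∀ t, 1 ≤ t → t ≤ T → ∀ ω e, 0 ≤ c t ω e ∧ c t ω e ≤ K := fun t h1 h2 ω e =>
    ⟨(hcost t h1 h2 ω).1 e,
      (le_abs_self _).trans ((norm_le_pi_norm (c t ω) e).trans (hcost t h1 h2 ω).2)⟩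
  exact ⟨fun δ hδ hδ2 => hrun.realizedRegret_tail hK hc hδ hδ2,
    hrun.integrable_mixedRegret (by linarith) hc, hrun.integral_mixedRegret_le hK hc⟩
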